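/- Let $\mathbb T^2=[-\tfrac12,\tfrac12]^2$ with Lebesgue measure. For $g\in L^1(\mathbb T^2)$ put $$\|g\|_{\mathrm{BMO}(\mathbb T^2)}=\sup_{Q\subset\mathbb T^2}\frac1{|Q|}\int_Q\Big|g(x)-\frac1{|Q|}\int_Q g\Big|\,dx\in[0,\infty],$$ where the supremum is over all nondegenerate closed squares $Q\subset\mathbb T^2$ with edges parallel to the axes. Let $$S=\{\varphi\in C_c^\infty(\mathbb R^2):\ \mathrm{supp}\,\varphi\subset B(0,1),\ \max\{\|\varphi\|_\infty,\|\nabla\varphi\|_\infty\}\le1\},$$ where $B(x,r)$ is the open Euclidean ball, and for $f\in L^1(\mathbb T^2)$ and $x\in\mathbb T^2$ define the local maximal function $$\mathcal Mf(x)=\sup_{\varphi\in S}\ \sup_{0<r\le1}\left|\frac1{|B(x,r)|}\int_{\mathbb T^2}\varphi\Big(\frac{x-y}r\Big)f(y)\,dy\right|.$$ Then there is an absolute constant $C\ge 0$ such that for all real-valued $f,g\in L^1(\mathbb T^2)$ with $fg\in L^1(\mathbb T^2)$ and such that at least one of $f$ and $g$ has mean zero, i.e. $\int_{\mathbb T^2}f\,dx=0$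 or $\int_{\mathbb T^2}g\,dx=0$, $$\left|\int_{\mathbb T^2}f(x)g(x)\,dx\right|\le C\,\|\mathcal Mf\|_{L^1(\mathbb T^2)}\,\|g\|_{\mathrm{BMO}(\mathbb T^2)}.$$ (Norms may be infinite, with the convention $0\cdot\infty=0$.) -/

import Mathlib

open MeasureTheory

noncomputable section

namespace TorusDuality

/-- The closed unit cube `[-1/2, 1/2]^d`, the fundamental domain that models the torus `𝕋^d`. -/
def torus (d : ℕ) : Set (EuclideanSpace ℝ (Fin d)) :=
  {x | ∀ i, x i ∈ Set.Icc (-(1 / 2) : ℝ) (1 / 2)}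

/-- The measure `μ(B) = |torus ∩ B|` on `ℝ^d`. -/
def torusMeasure (d : ℕ) : Measure (EuclideanSpace ℝ (Fin d)) :=
  volume.restrict (torus d)

/-- The cube with lower corner `a`, side length `l` and edges parallel to the axes. -/
def cube {d : ℕ} (a : EuclideanSpace ℝ (Fin d)) (l : ℝ) : Set (EuclideanSpace ℝ (Fin d)) :=
  {x | ∀ i, x i ∈ Set.Icc (a i) (a i + l)}

/-- The `BMO(Ω)` norm: the supremum, over all nondegenerate axis-parallel cubes `Q ⊆ Ω`, of the
mean over `Q` of `|f - f_Q|`, where `f_Q` is the mean of `f` over `Q` (Lebesgue measure). -/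
def bmoNorm {d : ℕ} (Ω : Set (EuclideanSpace ℝ (Fin d))) (f : EuclideanSpace ℝ (Fin d) → ℝ) :
    ENNReal :=
  ⨆ (a : EuclideanSpace ℝ (Fin d)) (l : ℝ) (_ : 0 < l) (_ : cube a l ⊆ Ω),
    (volume (cube a l))⁻¹ * ∫⁻ x in cube a l, ‖f x - ⨍ y in cube a l, f y‖ₑ

/-- The class `S` of smooth compactly supported functions on `ℝ^d` with support in the unit ball
and with `‖φ‖_∞ ≤ 1`, `‖∇φ‖_∞ ≤ 1`. (The operator norm of the derivative is the Euclidean norm of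
the gradient.) -/
def testFunctions (d : ℕ) : Set (EuclideanSpace ℝ (Fin d) → ℝ) :=
  {φ | ContDiff ℝ (⊤ : ℕ∞) φ ∧ HasCompactSupport φ ∧ tsupport φ ⊆ Metric.ball 0 1 ∧
    (∀ x, |φ x| ≤ 1) ∧ ∀ x, ‖fderiv ℝ φ x‖ ≤ 1}

/-- The local smooth maximal function
`𝓜f(x) = sup_{φ ∈ S} sup_{0 < r ≤ 1} | |B(x,r)|⁻¹ ∫ φ((x-y)/r) f(y) dμ(y) |`,
with `|B(x,r)|` the Lebesgue measure of the ball. -/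
def localMaximal {d : ℕ} (μ : Measure (EuclideanSpace ℝ (Fin d)))
    (f : EuclideanSpace ℝ (Fin d) → ℝ) (x : EuclideanSpace ℝ (Fin d)) : ENNReal :=
  ⨆ (φ ∈ testFunctions d) (r : ℝ) (_ : 0 < r) (_ : r ≤ 1),
    ‖(volume.real (Metric.ball x r))⁻¹ * ∫ y, φ (r⁻¹ • (x - y)) * f y ∂μ‖ₑ

end TorusDuality

end

open Metric Filter Topology

set_option linter.unusedSectionVars false

/-! Let M be a fixed multiple of the maximal function, I its integral, c the mean of g, A a multiple
of the BMO norm. For a level t put O_t = {M > t} and let δ_t be an eighth of the distance to the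
complement of O_t, as in a Whitney decomposition. Let G_t be g averaged at the variable scale δ_t,
so that G_t = g off O_t. Along the levels t_k = 2^k a, writing G_k and O_k for G_{t_k} and O_{t_k},
the pairing telescopes: ∫ f (g - c) = ∫ f (G_0 - c) + Σ_k ∫ f (G_{k+1} - G_k). For bounded g this
converges by domination, since M < ∞ almost everywhere makes G_k(x) = g(x) for large k; truncation
of g handles the rest.

Every term is an instance of `abs_integral_mul_smoothing_sub_le`: if h is Lipschitz with constant L
/ δ_t at scale δ_t, then |∫ f (G_t - h)| ≤ C t (∫ |g - h| + L |O_t|). Off O_t one has |f| ≤ C t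
almost everywhere by Lebesgue differentiation. On O_t the tent kernel is a continuous partition of
unity that cuts G_t - h into Lipschitz bumps of width δ_t(y); each lies near a point where M ≤ t and
can be tested there. No atomic decomposition of f is needed. Taking h = c and L = 0 bounds the first
term by C a A. Taking h = G_k at level t_{k+1} bounds the k-th difference by C A t_k |O_k|, because
`HasOscillation` gives both ∫ |g - G_k| ≤ C A |O_k| and L = C A. Finally Σ t_k |O_k| ≤ 2 I.

Since M only sees bounded radii, a = 1024 I is chosen so that O_0 contains no ball of radius 1/8,
which keeps every scale at most 1/64. The argument runs on the square as a metric space in its own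
right and uses only Ahlfors regularity. The boundary is harmless: f is extended by zero, and a
Lipschitz bump on the square extends to an admissible test function that need not vanish at the
boundary. -/

namespace TorusDuality

/-! ### Tents at a variable scale on a planar metric measure space. -/

section MetricMeasureSpace

variable {X : Type*} [MetricSpace X] [MeasurableSpace X] [BorelSpace X]
  [SecondCountableTopology X] {μ : Measure X} [IsFiniteMeasure μ] {δ : X → ℝ}

/-- Two-dimensional Ahlfors regularity, with explicit constants. -/
structure IsPlanar (μ : Measure X) : Prop where
  lower : ∀ x r, 0 < r → r ≤ 1 → r ^ 2 / 4 ≤ μ.real (ball x r)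
  upper : ∀ x r, 0 < r → μ.real (ball x r) ≤ 4 * r ^ 2

/-- A slowly varying length scale. -/
structure IsScale (δ : X → ℝ) : Prop where
  nonneg : ∀ x, 0 ≤ δ x
  le_one : ∀ x, δ x ≤ 1
  lip : ∀ x y, δ x ≤ δ y + dist x y / 8

/-- The tent of height and radius `δ x` centred at `x`. -/
noncomputable def tent (δ : X → ℝ) (x y : X) : ℝ := max 0 (δ x - dist x y)

/-- The tent kernel normalised to have mass one in the second variable. -/
noncomputable def tentKernel (μ : Measure X) (δ : X → ℝ) (x y : X) : ℝ :=
  tent δ x y / ∫ z, tent δ x z ∂μ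

/-- The average of `g` at the variable scale `δ`; where `δ` vanishes, `g` is left unchanged. -/
noncomputable def smoothing (μ : Measure X) (δ : X → ℝ) (g : X → ℝ) (x : X) : ℝ :=
  open Classical in if 0 < δ x then ∫ z, tentKernel μ δ x z * g z ∂μ else g x

namespace IsScale

theorem lip' (hδ : IsScale δ) (x y : X) : δ y ≤ δ x + dist x y / 8 := by
  have := hδ.lip y x
  rwa [dist_comm y x] at this

theorem continuous (hδ : IsScale δ) : Continuous δ := by
  have : LipschitzWith 1 δ := LipschitzWith.of_le_add_mul 1 fun x y => by
    have := hδ.lip x y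
    have := dist_nonneg (x := x) (y := y)
    simp only [NNReal.coe_one]
    linarith
  exact this.continuous

/-- The factor 1/8 in `IsScale.lip` is chosen for this: over a distance 4 δ y the scale moves by at
most δ y / 2. -/
theorem comparable (hδ : IsScale δ) {x y : X} (h : dist x y ≤ 4 * δ y) :
    δ y / 2 ≤ δ x ∧ δ x ≤ 3 / 2 * δ y := by
  have := hδ.lip x y
  have := hδ.lip' x y
  constructor <;> linarith

end IsScale

theorem tent_nonneg (x y : X) : 0 ≤ tent δ x y := le_max_left _ _

theorem tent_le (hδ : IsScale δ) (x y : X) : tent δ x y ≤ δ x :=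
  max_le (hδ.nonneg x) (by linarith [dist_nonneg (x := x) (y := y)])

theorem dist_lt_of_tent_ne_zero {x y : X} (h : tent δ x y ≠ 0) : dist x y < δ x := by
  by_contra! h'
  exact h (max_eq_left (by linarith))

theorem abs_tent_sub_le (hδ : IsScale δ) (x x' y : X) :
    |tent δ x y - tent δ x' y| ≤ 2 * dist x x' := by
  have h1 := hδ.lip x x'
  have h2 := hδ.lip' x x'
  have h3 := abs_dist_sub_le x x' y
  have h4 := dist_nonneg (x := x) (y := x')
  refine (abs_max_sub_max_le_max 0 (δ x - dist x y) 0 (δ x' - dist x' y)).trans ?_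
  rw [abs_le] at h3
  refine max_le (by simp) (abs_le.2 ⟨?_, ?_⟩) <;> linarith [h3.1, h3.2]

theorem continuous_tent (hδ : IsScale δ) : Continuous fun p : X × X => tent δ p.1 p.2 :=
  continuous_const.max ((hδ.continuous.comp continuous_fst).sub continuous_dist)

theorem integrable_tent (hδ : IsScale δ) (x : X) : Integrable (tent δ x) μ := by
  have hc : Continuous (tent δ x) := (continuous_tent hδ).comp (Continuous.prodMk_right x)
  refine Integrable.of_bound hc.aestronglyMeasurable (δ x) (.of_forall fun y => ?_)
  rw [Real.norm_of_nonneg (tent_nonneg x y)]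
  exact tent_le hδ x y

/-- The tent is at least half its height on the ball of half its radius: (δ/2) · (δ/2)²/4 = δ³/32.
-/
theorem le_integral_tent (hμ : IsPlanar μ) (hδ : IsScale δ) (x : X) :
    δ x ^ 3 / 32 ≤ ∫ z, tent δ x z ∂μ := by
  rcases (hδ.nonneg x).eq_or_lt with h0 | h0
  · rw [← h0]
    simpa using integral_nonneg fun z => tent_nonneg x z
  have hl := hμ.lower x (δ x / 2) (by linarith) (by linarith [hδ.le_one x])
  calc δ x ^ 3 / 32 = δ x / 2 * ((δ x / 2) ^ 2 / 4) := by ring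
    _ ≤ δ x / 2 * μ.real (ball x (δ x / 2)) := by gcongr
    _ = ∫ z in ball x (δ x / 2), δ x / 2 ∂μ := by simp [mul_comm]
    _ ≤ ∫ z in ball x (δ x / 2), tent δ x z ∂μ := by
        refine setIntegral_mono_on (by simp) (integrable_tent hδ x).integrableOn
          measurableSet_ball fun z hz => ?_
        rw [mem_ball, dist_comm] at hz
        exact le_max_of_le_right (by linarith)
    _ ≤ ∫ z, tent δ x z ∂μ :=
        setIntegral_le_integral (integrable_tent hδ x) (.of_forall fun z => tent_nonneg x z)

theorem integral_tent_nonneg (x : X) : 0 ≤ ∫ z, tent δ x z ∂μ :=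
  integral_nonneg fun z => tent_nonneg x z

theorem integral_tent_pos (hμ : IsPlanar μ) (hδ : IsScale δ) {x : X} (hx : 0 < δ x) :
    0 < ∫ z, tent δ x z ∂μ :=
  lt_of_lt_of_le (by positivity) (le_integral_tent hμ hδ x)

theorem tentKernel_nonneg (x y : X) : 0 ≤ tentKernel μ δ x y :=
  div_nonneg (tent_nonneg x y) (integral_tent_nonneg x)

theorem dist_lt_of_tentKernel_ne_zero {x y : X} (h : tentKernel μ δ x y ≠ 0) :
    dist x y < δ x :=
  dist_lt_of_tent_ne_zero fun h0 => h (by simp [tentKernel, h0])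

theorem measurable_tentKernel (hδ : IsScale δ) :
    Measurable fun p : X × X => tentKernel μ δ p.1 p.2 := by
  have hc := continuous_tent hδ
  refine hc.measurable.div ?_
  have : StronglyMeasurable fun x => ∫ z, tent δ x z ∂μ :=
    StronglyMeasurable.integral_prod_right (f := tent δ) hc.stronglyMeasurable
  exact this.measurable.comp measurable_fst

theorem integrable_tentKernel (hδ : IsScale δ) (x : X) : Integrable (tentKernel μ δ x) μ :=
  (integrable_tent hδ x).div_const _

theorem integral_tentKernel (hμ : IsPlanar μ) (hδ : IsScale δ) {x : X} (hx : 0 < δ x) :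
    ∫ y, tentKernel μ δ x y ∂μ = 1 := by
  simp only [tentKernel]
  rw [integral_div, div_self (integral_tent_pos hμ hδ hx).ne']

theorem tentKernel_eq_zero {x : X} (hx : ¬ 0 < δ x) (y : X) :
    tentKernel μ δ x y = 0 := by
  by_contra h
  exact hx (dist_nonneg.trans_lt (dist_lt_of_tentKernel_ne_zero h))

section Local

variable {x x' y : X}

theorem le_integral_tent_of_dist (hμ : IsPlanar μ) (hδ : IsScale δ)
    (hx : dist x y ≤ 4 * δ y) : δ y ^ 3 / 256 ≤ ∫ z, tent δ x z ∂μ := by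
  have h1 := (hδ.comparable hx).1
  have h0 := hδ.nonneg y
  calc δ y ^ 3 / 256 = (δ y / 2) ^ 3 / 32 := by ring
    _ ≤ δ x ^ 3 / 32 := by gcongr
    _ ≤ _ := le_integral_tent hμ hδ x

theorem tentKernel_le (hμ : IsPlanar μ) (hδ : IsScale δ) (hy : 0 < δ y)
    (hx : dist x y ≤ 4 * δ y) (z : X) : tentKernel μ δ x z ≤ 384 / δ y ^ 2 := by
  have h1 := le_integral_tent_of_dist hμ hδ hx
  have h2 := (tent_le hδ x z).trans (hδ.comparable hx).2
  calc tentKernel μ δ x z ≤ (3 / 2 * δ y) / (δ y ^ 3 / 256) := by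
        unfold tentKernel; gcongr
    _ = 384 / δ y ^ 2 := by field_simp; norm_num

theorem abs_integral_tent_sub_le (hμ : IsPlanar μ) (hδ : IsScale δ) (hy : 0 < δ y)
    (hx : dist x y ≤ 4 * δ y) (hx' : dist x' y ≤ 4 * δ y) :
    |(∫ z, tent δ x z ∂μ) - ∫ z, tent δ x' z ∂μ| ≤ 288 * dist x x' * δ y ^ 2 := by
  have h1 := (hδ.comparable hx).2
  have h2 := (hδ.comparable hx').2
  rw [← integral_sub (integrable_tent hδ x) (integrable_tent hδ x')]
  have hb : ∀ z, ‖tent δ x z - tent δ x' z‖ ≤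
      (ball y (6 * δ y)).indicator (fun _ => 2 * dist x x') z := by
    intro z
    by_cases hz : z ∈ ball y (6 * δ y)
    · rw [Set.indicator_of_mem hz]
      exact abs_tent_sub_le hδ x x' z
    · rw [Set.indicator_of_notMem hz]
      rw [mem_ball, not_lt] at hz
      have e1 : tent δ x z = 0 := by
        by_contra h
        have := dist_lt_of_tent_ne_zero h
        have := dist_triangle_left z y x
        linarith
      have e2 : tent δ x' z = 0 := by
        by_contra h
        have := dist_lt_of_tent_ne_zero h
        have := dist_triangle_left z y x'
        linarith
      simp [e1, e2]
  have hi : Integrable ((ball y (6 * δ y)).indicator fun _ => 2 * dist x x') μ :=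
    (integrable_const _).indicator measurableSet_ball
  have h3 := hμ.upper y (6 * δ y) (by linarith)
  have h4 := dist_nonneg (x := x) (y := x')
  calc _ ≤ ∫ z, (ball y (6 * δ y)).indicator (fun _ => 2 * dist x x') z ∂μ :=
        norm_integral_le_of_norm_le hi (.of_forall hb)
    _ = μ.real (ball y (6 * δ y)) * (2 * dist x x') := by
        rw [integral_indicator measurableSet_ball]; simp
    _ ≤ 4 * (6 * δ y) ^ 2 * (2 * dist x x') := by gcongr
    _ = _ := by ring

/-- Quotient rule: the kernel has size δ⁻², and both the tent and its mass vary by a relative amount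
of order dist / δ. -/
theorem abs_tentKernel_sub_le (hμ : IsPlanar μ) (hδ : IsScale δ) (hy : 0 < δ y)
    (hx : dist x y ≤ 4 * δ y) (hx' : dist x' y ≤ 4 * δ y) (z : X) :
    |tentKernel μ δ x z - tentKernel μ δ x' z| ≤ 10 ^ 8 * dist x x' / δ y ^ 3 := by
  have hU := le_integral_tent_of_dist hμ hδ hx
  have hU' := le_integral_tent_of_dist hμ hδ hx'
  have hd := abs_integral_tent_sub_le hμ hδ hy hx hx'
  have hu := abs_tent_sub_le hδ x x' z
  have hu' := (tent_le hδ x' z).trans (hδ.comparable hx').2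
  have h0 := tent_nonneg (δ := δ) x' z
  have h4 := dist_nonneg (x := x) (y := x')
  unfold tentKernel
  set U := ∫ z, tent δ x z ∂μ
  set U' := ∫ z, tent δ x' z ∂μ
  set u := tent δ x z
  set u' := tent δ x' z
  have hp : 0 < δ y ^ 3 / 256 := by positivity
  have hUp : 0 < U := hp.trans_le hU
  have hUp' : 0 < U' := hp.trans_le hU'
  have e : u / U - u' / U' = (u - u') / U - u' * (U - U') / (U * U') := by
    field_simp; ring
  rw [e]
  calc |(u - u') / U - u' * (U - U') / (U * U')|
      ≤ |(u - u') / U| + |u' * (U - U') / (U * U')| := abs_sub _ _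
    _ = |u - u'| / U + u' * |U - U'| / (U * U') := by
        rw [abs_div, abs_div, abs_mul, abs_of_pos hUp, abs_of_pos (mul_pos hUp hUp'),
          abs_of_nonneg h0]
    _ ≤ 2 * dist x x' / (δ y ^ 3 / 256) + (3 / 2 * δ y) * (288 * dist x x' * δ y ^ 2) /
          (δ y ^ 3 / 256 * (δ y ^ 3 / 256)) := by gcongr
    _ = 28312064 * dist x x' / δ y ^ 3 := by field_simp; ring
    _ ≤ _ := by gcongr; norm_num

end Local

theorem abs_integral_mul_le_of_support {k p : X → ℝ} {B : Set X} {c : ℝ}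
    (hB : MeasurableSet B) (hp : Integrable p μ) (hk : ∀ z, |k z| ≤ c)
    (hkB : ∀ z, k z ≠ 0 → z ∈ B) : |∫ z, k z * p z ∂μ| ≤ c * ∫ z in B, |p z| ∂μ := by
  have hi : Integrable (B.indicator fun z => c * |p z|) μ :=
    (hp.abs.const_mul c).indicator hB
  rw [← integral_const_mul, ← integral_indicator (μ := μ) hB]
  change ‖∫ z, k z * p z ∂μ‖ ≤ _
  refine norm_integral_le_of_norm_le hi (.of_forall fun z => ?_)
  by_cases hz : z ∈ B
  · rw [Set.indicator_of_mem hz, Real.norm_eq_abs, abs_mul]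
    exact mul_le_mul_of_nonneg_right (hk z) (abs_nonneg _)
  · rw [Set.indicator_of_notMem hz]
    have : k z = 0 := by_contra fun h => hz (hkB z h)
    simp [this]

/-! ### Averages of a function at a variable scale. -/

section Smoothing

variable {g : X → ℝ} {x x' y : X}

theorem smoothing_of_pos (hx : 0 < δ x) :
    smoothing μ δ g x = ∫ z, tentKernel μ δ x z * g z ∂μ := if_pos hx

theorem smoothing_of_not_pos (hx : ¬ 0 < δ x) : smoothing μ δ g x = g x := if_neg hx

theorem tentKernel_le_self (hμ : IsPlanar μ) (hδ : IsScale δ) (x z : X) :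
    tentKernel μ δ x z ≤ 384 / δ x ^ 2 := by
  by_cases hx : 0 < δ x
  · exact tentKernel_le hμ hδ hx (by simpa using hx.le) z
  · rw [tentKernel_eq_zero hx]; positivity

theorem integrable_tentKernel_mul (hμ : IsPlanar μ) (hδ : IsScale δ) {p : X → ℝ}
    (hp : Integrable p μ) (x : X) : Integrable (fun z => tentKernel μ δ x z * p z) μ := by
  refine hp.bdd_mul (c := 384 / δ x ^ 2) (integrable_tentKernel hδ x).aestronglyMeasurable
    (.of_forall fun z => ?_)
  rw [Real.norm_of_nonneg (tentKernel_nonneg x z)]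
  exact tentKernel_le_self hμ hδ x z

theorem smoothing_sub (hμ : IsPlanar μ) (hδ : IsScale δ) (hg : Integrable g μ) (hx : 0 < δ x)
    (m : ℝ) : smoothing μ δ g x - m = ∫ z, tentKernel μ δ x z * (g z - m) ∂μ := by
  simp only [mul_sub]
  rw [integral_sub (integrable_tentKernel_mul hμ hδ hg x)
    ((integrable_tentKernel hδ x).mul_const m), integral_mul_const,
    integral_tentKernel hμ hδ hx, one_mul, smoothing_of_pos hx]

theorem mem_ball_of_tentKernel_ne_zero (hδ : IsScale δ) (hy : 0 < δ y) {ρ : ℝ} (hρ : ρ ≤ 4)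
    (hx : dist x y ≤ ρ * δ y) {z : X} (hz : tentKernel μ δ x z ≠ 0) :
    z ∈ ball y ((ρ + 2) * δ y) := by
  have h1 := dist_lt_of_tentKernel_ne_zero hz
  have h2 := (hδ.comparable (hx.trans (by gcongr))).2
  have h3 := dist_triangle_left z y x
  rw [mem_ball]
  linarith

theorem abs_smoothing_sub_const_le (hμ : IsPlanar μ) (hδ : IsScale δ) (hg : Integrable g μ)
    (hy : 0 < δ y) {ρ : ℝ} (hρ : ρ ≤ 4) (hx : dist x y ≤ ρ * δ y) (m : ℝ) :
    |smoothing μ δ g x - m| ≤ 384 / δ y ^ 2 * ∫ z in ball y ((ρ + 2) * δ y), |g z - m| ∂μ := by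
  have h4 : dist x y ≤ 4 * δ y := hx.trans (by gcongr)
  have hx0 : 0 < δ x := by linarith [(hδ.comparable h4).1]
  rw [smoothing_sub hμ hδ hg hx0]
  refine abs_integral_mul_le_of_support measurableSet_ball (hg.sub (integrable_const m))
    (fun z => ?_) fun z hz => mem_ball_of_tentKernel_ne_zero hδ hy hρ hx hz
  rw [abs_of_nonneg (tentKernel_nonneg x z)]
  exact tentKernel_le hμ hδ hy h4 z

/-- Both kernels have mass one, so a constant `m` can be subtracted from `g` before the Lipschitz
bound on the kernel is applied; only the oscillation of `g` then enters. -/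
theorem abs_smoothing_sub_le (hμ : IsPlanar μ) (hδ : IsScale δ) (hg : Integrable g μ)
    (hy : 0 < δ y) {ρ : ℝ} (hρ : ρ ≤ 4) (hx : dist x y ≤ ρ * δ y) (hx' : dist x' y ≤ ρ * δ y)
    (m : ℝ) : |smoothing μ δ g x - smoothing μ δ g x'| ≤
      10 ^ 8 * dist x x' / δ y ^ 3 * ∫ z in ball y ((ρ + 2) * δ y), |g z - m| ∂μ := by
  have h4 : dist x y ≤ 4 * δ y := hx.trans (by gcongr)
  have h4' : dist x' y ≤ 4 * δ y := hx'.trans (by gcongr)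
  have hx0 : 0 < δ x := by linarith [(hδ.comparable h4).1]
  have hx0' : 0 < δ x' := by linarith [(hδ.comparable h4').1]
  have hgm : Integrable (fun z => g z - m) μ := hg.sub (integrable_const m)
  have e : smoothing μ δ g x - smoothing μ δ g x' =
      ∫ z, (tentKernel μ δ x z - tentKernel μ δ x' z) * (g z - m) ∂μ := by
    simp only [sub_mul (tentKernel μ δ x _)]
    rw [integral_sub (integrable_tentKernel_mul hμ hδ hgm x)
      (integrable_tentKernel_mul hμ hδ hgm x')]
    have := smoothing_sub hμ hδ hg hx0 m
    have := smoothing_sub hμ hδ hg hx0' m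
    linarith
  rw [e]
  refine abs_integral_mul_le_of_support measurableSet_ball hgm
    (fun z => abs_tentKernel_sub_le (μ := μ) hμ hδ hy h4 h4' z) fun z hz => ?_
  by_cases h : tentKernel μ δ x z = 0
  · refine mem_ball_of_tentKernel_ne_zero (μ := μ) hδ hy hρ hx' fun h' => hz ?_
    rw [h, h', sub_zero]
  · exact mem_ball_of_tentKernel_ne_zero hδ hy hρ hx h

theorem abs_smoothing_le (hμ : IsPlanar μ) (hδ : IsScale δ) {N : ℝ} (hN : ∀ x, |g x| ≤ N)
    (x : X) : |smoothing μ δ g x| ≤ N := by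
  by_cases hx : 0 < δ x
  · rw [smoothing_of_pos hx]
    have h1 : ∫ z, tentKernel μ δ x z * N ∂μ = N := by
      rw [integral_mul_const, integral_tentKernel hμ hδ hx, one_mul]
    change ‖∫ z, tentKernel μ δ x z * g z ∂μ‖ ≤ N
    refine (norm_integral_le_of_norm_le ((integrable_tentKernel (μ := μ) hδ x).mul_const N)
      (.of_forall fun z => ?_)).trans h1.le
    rw [norm_mul, Real.norm_of_nonneg (tentKernel_nonneg x z)]
    exact mul_le_mul_of_nonneg_left (hN z) (tentKernel_nonneg x z)
  · rw [smoothing_of_not_pos hx]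
    exact hN x

theorem measurable_smoothing (hδ : IsScale δ) (hg : Measurable g) :
    Measurable (smoothing μ δ g) := by
  refine Measurable.ite (measurableSet_lt measurable_const hδ.continuous.measurable) ?_ hg
  have : StronglyMeasurable fun x => ∫ z, tentKernel μ δ x z * g z ∂μ :=
    StronglyMeasurable.integral_prod_right (f := fun x z => tentKernel μ δ x z * g z)
      ((measurable_tentKernel hδ).mul (hg.comp measurable_snd)).stronglyMeasurable
  exact this.measurable

/-- Mean oscillation at most `A`, normalised by the square of the radius. -/
def HasOscillation (μ : Measure X) (g : X → ℝ) (A : ℝ) : Prop :=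
  ∀ y r, 0 < r → ∃ m, ∫ x in ball y r, |g x - m| ∂μ ≤ A * r ^ 2

theorem HasOscillation.abs_smoothing_sub_le {A : ℝ} (hA : HasOscillation μ g A)
    (hμ : IsPlanar μ) (hδ : IsScale δ) (hg : Integrable g μ)
    (hy : 0 < δ y) (hx : dist x y ≤ 4 * δ y) (hx' : dist x' y ≤ 4 * δ y) :
    |smoothing μ δ g x - smoothing μ δ g x'| ≤ 10 ^ 10 * A * dist x x' / δ y := by
  obtain ⟨m, hm⟩ := hA y ((4 + 2) * δ y) (by positivity)
  refine (TorusDuality.abs_smoothing_sub_le hμ hδ hg hy le_rfl hx hx' m).trans ?_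
  have hA0 : 0 ≤ A * ((4 + 2) * δ y) ^ 2 := le_trans (by positivity) hm
  have hA1 : 0 ≤ A := nonneg_of_mul_nonneg_left hA0 (by positivity)
  calc _ ≤ 10 ^ 8 * dist x x' / δ y ^ 3 * (A * ((4 + 2) * δ y) ^ 2) := by gcongr
    _ = 36 * 10 ^ 8 * A * dist x x' / δ y := by field_simp; ring
    _ ≤ _ := by gcongr; norm_num

end Smoothing

/-! ### The tent kernel as a continuous partition of unity. -/

/-- A kernel with bounded column integrals maps `L¹` to `L¹`; this is the integrability that
makes Fubini's theorem applicable. -/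
theorem integrable_kernel_mul {k : X → X → ℝ} {p : X → ℝ} {c : ℝ}
    (hk : Measurable fun q : X × X => k q.1 q.2) (hk0 : ∀ x y, 0 ≤ k x y)
    (hki : ∀ x, Integrable (k x) μ) (hkc : ∀ x, ∫ y, k x y ∂μ ≤ c) (hp : Integrable p μ) :
    Integrable (fun q : X × X => k q.1 q.2 * p q.1) (μ.prod μ) := by
  have hm : AEStronglyMeasurable (fun q : X × X => k q.1 q.2 * p q.1) (μ.prod μ) :=
    hk.aestronglyMeasurable.mul hp.aestronglyMeasurable.comp_fst
  rw [integrable_prod_iff hm]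
  refine ⟨.of_forall fun x => (hki x).mul_const (p x), ?_⟩
  refine (hp.norm.const_mul c).mono' hm.norm.integral_prod_right' (.of_forall fun x => ?_)
  simp only [norm_mul, integral_mul_const, Real.norm_of_nonneg (hk0 _ _)]
  rw [norm_norm, Real.norm_of_nonneg (integral_nonneg (hk0 x))]
  exact mul_le_mul_of_nonneg_right (hkc x) (norm_nonneg _)

theorem integrable_tentKernel_reproduce (hμ : IsPlanar μ) (hδ : IsScale δ) {p : X → ℝ}
    (hp : Integrable p μ) :
    Integrable (fun q : X × X => tentKernel μ δ q.1 q.2 * p q.1) (μ.prod μ) := by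
  refine integrable_kernel_mul (c := 1) (measurable_tentKernel hδ) tentKernel_nonneg
    (integrable_tentKernel hδ) (fun x => ?_) hp
  by_cases hx : 0 < δ x
  · exact (integral_tentKernel hμ hδ hx).le
  · simp [tentKernel_eq_zero hx]

/-- The functions x ↦ K(x, y), indexed by y, integrate to one over y wherever δ x > 0; this replaces
a partition of unity subordinate to Whitney cubes. -/
theorem integral_eq_integral_tentKernel (hμ : IsPlanar μ) (hδ : IsScale δ) {p : X → ℝ}
    (hp : Integrable p μ) (hp0 : ∀ x, ¬ 0 < δ x → p x = 0) :
    ∫ x, p x ∂μ = ∫ y, ∫ x, tentKernel μ δ x y * p x ∂μ ∂μ := by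
  rw [← integral_integral_swap (integrable_tentKernel_reproduce hμ hδ hp)]
  refine integral_congr_ae (.of_forall fun x => ?_)
  simp only [integral_mul_const]
  by_cases hx : 0 < δ x
  · rw [integral_tentKernel hμ hδ hx, one_mul]
  · rw [hp0 x hx, mul_zero]

theorem measurableSet_pos (hδ : IsScale δ) : MeasurableSet {x | 0 < δ x} :=
  measurableSet_lt measurable_const hδ.continuous.measurable

theorem integrable_of_abs_le {g : X → ℝ} (hg : Measurable g) {N : ℝ} (hN : ∀ x, |g x| ≤ N) :
    Integrable g μ :=
  Integrable.of_bound hg.aestronglyMeasurable N (.of_forall hN)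

theorem dist_lt_two_of_tentKernel_ne_zero (hδ : IsScale δ) {x y : X}
    (h : tentKernel μ δ x y ≠ 0) : 0 < δ y ∧ dist x y < 3 / 2 * δ y := by
  have h1 := dist_lt_of_tentKernel_ne_zero h
  have h2 := hδ.lip x y
  have h3 := dist_nonneg (x := x) (y := y)
  constructor <;> linarith

/-- Localised by the partition of unity, the integral near y is an average of |g - G| at scale δ y,
hence at most a multiple of `A`; only points with δ y > 0 contribute. -/
theorem HasOscillation.integral_abs_sub_smoothing_le {g : X → ℝ} {A N : ℝ}
    (hA : HasOscillation μ g A) (hμ : IsPlanar μ) (hδ : IsScale δ) (hg : Measurable g)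
    (hN : ∀ x, |g x| ≤ N) :
    ∫ x, |g x - smoothing μ δ g x| ∂μ ≤ 10 ^ 8 * A * μ.real {x | 0 < δ x} := by
  have hgi : Integrable g μ := integrable_of_abs_le hg hN
  have hgm (m : ℝ) : Integrable (fun x => |g x - m|) μ := (hgi.sub (integrable_const m)).abs
  have hGi : Integrable (smoothing μ δ g) μ :=
    integrable_of_abs_le (measurable_smoothing hδ hg) (abs_smoothing_le hμ hδ hN)
  have hi : Integrable (fun x => |g x - smoothing μ δ g x|) μ := (hgi.sub hGi).abs
  rw [integral_eq_integral_tentKernel hμ hδ hi fun x hx => by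
    rw [smoothing_of_not_pos hx, sub_self, abs_zero]]
  have hO := measurableSet_pos hδ
  have hb : ∀ y, ∫ x, tentKernel μ δ x y * |g x - smoothing μ δ g x| ∂μ ≤
      {x | 0 < δ x}.indicator (fun _ => 10 ^ 8 * A) y := by
    intro y
    by_cases hy : 0 < δ y
    · rw [Set.indicator_of_mem (by exact hy)]
      -- One constant serves both `g` and its smoothing on the ball of radius 2 δ y, because the
      -- averages taken there only reach out to 4 δ y.
      obtain ⟨m, hm⟩ := hA y ((2 + 2) * δ y) (by positivity)
      have hm0 : 0 ≤ ∫ x in ball y ((2 + 2) * δ y), |g x - m| ∂μ :=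
        integral_nonneg fun _ => abs_nonneg _
      have hA0 : 0 ≤ A := nonneg_of_mul_nonneg_left (hm0.trans hm) (by positivity)
      have h1 : ∫ x, tentKernel μ δ x y * |g x - smoothing μ δ g x| ∂μ ≤
          384 / δ y ^ 2 * ∫ x in ball y (2 * δ y), |(|g x - smoothing μ δ g x|)| ∂μ := by
        refine (le_abs_self _).trans
          (abs_integral_mul_le_of_support measurableSet_ball hi (fun x => ?_) fun x hx => ?_)
        · rw [abs_of_nonneg (tentKernel_nonneg x y)]
          by_cases h : tentKernel μ δ x y = 0
          · rw [h]; positivity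
          · have := (dist_lt_two_of_tentKernel_ne_zero hδ h).2
            exact tentKernel_le hμ hδ hy (by linarith) y
        · have := (dist_lt_two_of_tentKernel_ne_zero hδ hx).2
          rw [mem_ball]; linarith
      have h2 : ∫ x in ball y (2 * δ y), |(|g x - smoothing μ δ g x|)| ∂μ ≤
          ∫ x in ball y (2 * δ y), (|g x - m| + 384 / δ y ^ 2 * (A * ((2 + 2) * δ y) ^ 2)) ∂μ := by
        refine setIntegral_mono_on hi.abs.integrableOn
          ((hgm m).add (integrable_const _)).integrableOn
          measurableSet_ball fun x hx => ?_
        rw [abs_abs]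
        have h3 := abs_smoothing_sub_const_le hμ hδ hgi hy (by norm_num : (2 : ℝ) ≤ 4)
          (mem_ball.1 hx).le m
        calc |g x - smoothing μ δ g x| = |(g x - m) - (smoothing μ δ g x - m)| := by
              congr 1; ring
          _ ≤ |g x - m| + |smoothing μ δ g x - m| := abs_sub _ _
          _ ≤ _ := by gcongr; exact h3.trans (by gcongr)
      have h4 : ∫ x in ball y (2 * δ y), |g x - m| ∂μ ≤ A * ((2 + 2) * δ y) ^ 2 := by
        refine le_trans ?_ hm
        refine setIntegral_mono_set (hgm m).integrableOn
          (.of_forall fun _ => abs_nonneg _) (LE.le.eventuallyLE ?_)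
        exact ball_subset_ball (by linarith)
      have h5 := hμ.upper y (2 * δ y) (by positivity)
      rw [integral_add (hgm m).integrableOn
        (integrable_const _)] at h2
      simp only [integral_const, measureReal_restrict_apply_univ, smul_eq_mul] at h2
      calc _ ≤ 384 / δ y ^ 2 * (A * ((2 + 2) * δ y) ^ 2 +
            4 * (2 * δ y) ^ 2 * (384 / δ y ^ 2 * (A * ((2 + 2) * δ y) ^ 2))) := by
            refine h1.trans ?_
            gcongr
            refine h2.trans ?_
            gcongr
        _ = 37754880 * A := by field_simp; ring
        _ ≤ _ := by gcongr; norm_num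
    · rw [Set.indicator_of_notMem (by exact hy)]
      refine le_of_eq (integral_eq_zero_of_ae (.of_forall fun x => ?_))
      by_contra h
      exact hy (dist_lt_two_of_tentKernel_ne_zero hδ (left_ne_zero_of_mul h)).1
  calc _ ≤ ∫ y, {x | 0 < δ x}.indicator (fun _ => 10 ^ 8 * A) y ∂μ :=
        integral_mono (integrable_tentKernel_reproduce hμ hδ hi).integral_prod_right
          ((integrable_const _).indicator hO) hb
    _ = _ := by rw [integral_indicator hO]; simp [mul_comm]

/-- The kernel of averaging over balls of radius `4 δ y`. -/
noncomputable def ballKernel (δ : X → ℝ) (z y : X) : ℝ :=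
  {q : X × X | dist q.1 q.2 < 4 * δ q.2}.indicator (fun q => (δ q.2 ^ 2)⁻¹) (z, y)

theorem ballKernel_nonneg (z y : X) : 0 ≤ ballKernel δ z y :=
  Set.indicator_nonneg (fun _ _ => by positivity) _

theorem measurable_ballKernel (hδ : IsScale δ) :
    Measurable fun q : X × X => ballKernel δ q.1 q.2 := by
  have h2 : Measurable fun q : X × X => δ q.2 := hδ.continuous.measurable.comp measurable_snd
  exact (h2.pow_const 2).inv.indicator
    (measurableSet_lt continuous_dist.measurable (h2.const_mul 4))

/-- Comparability of the scales bounds the kernel by a function centred at `z`, which makes its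
integral in the other variable uniformly bounded and Fubini applicable. -/
theorem ballKernel_le (hδ : IsScale δ) (z y : X) :
    ballKernel δ z y ≤ (ball z (8 * δ z)).indicator (fun _ => 9 / 4 / δ z ^ 2) y := by
  by_cases h : dist z y < 4 * δ y
  · have hy : 0 < δ y := by linarith [dist_nonneg (x := z) (y := y)]
    obtain ⟨h1, h2⟩ := hδ.comparable h.le
    have hz : 0 < δ z := by linarith
    have hm : y ∈ ball z (8 * δ z) := by rw [mem_ball, dist_comm]; linarith
    rw [Set.indicator_of_mem hm, ballKernel, Set.indicator_of_mem (by exact h)]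
    rw [inv_le_iff_one_le_mul₀ (by positivity), div_mul_eq_mul_div,
      one_le_div (by positivity)]
    nlinarith
  · rw [ballKernel, Set.indicator_of_notMem (by exact h)]
    exact Set.indicator_nonneg (fun _ _ => by positivity) _

theorem integrable_ballKernel (hδ : IsScale δ) (z : X) : Integrable (ballKernel δ z) μ := by
  refine Integrable.mono' (g := (ball z (8 * δ z)).indicator fun _ => 9 / 4 / δ z ^ 2)
    ((integrable_const _).indicator measurableSet_ball) ((measurable_ballKernel hδ).comp measurable_prodMk_left).aestronglyMeasurable
    (.of_forall fun y => ?_)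
  rw [Real.norm_of_nonneg (ballKernel_nonneg z y)]
  exact ballKernel_le hδ z y

theorem integral_ballKernel_le (hμ : IsPlanar μ) (hδ : IsScale δ) (z : X) :
    ∫ y, ballKernel δ z y ∂μ ≤ 576 := by
  have h1 : ∫ y, ballKernel δ z y ∂μ ≤ μ.real (ball z (8 * δ z)) * (9 / 4 / δ z ^ 2) := by
    refine (integral_mono (integrable_ballKernel hδ z)
      ((integrable_const (9 / 4 / δ z ^ 2)).indicator measurableSet_ball)
      (ballKernel_le hδ z)).trans (le_of_eq ?_)
    rw [integral_indicator measurableSet_ball]; simp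
  rcases (hδ.nonneg z).eq_or_lt with h0 | h0
  · refine h1.trans ?_
    rw [← h0]; norm_num
  · have h2 := hμ.upper z (8 * δ z) (by positivity)
    calc _ ≤ 4 * (8 * δ z) ^ 2 * (9 / 4 / δ z ^ 2) := h1.trans (by gcongr)
      _ = 576 := by field_simp; norm_num

theorem integral_ballKernel_mul (p : X → ℝ) (y : X) :
    ∫ z, ballKernel δ z y * p z ∂μ = (∫ z in ball y (4 * δ y), p z ∂μ) / δ y ^ 2 := by
  rw [← integral_indicator measurableSet_ball, ← integral_div]
  congr 1
  ext z
  by_cases h : dist z y < 4 * δ y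
  · rw [ballKernel, Set.indicator_of_mem (by exact h), Set.indicator_of_mem (by exact h)]
    ring
  · rw [ballKernel, Set.indicator_of_notMem (by exact h), Set.indicator_of_notMem (by exact h)]
    ring

/-- Integrals of `f` against functions living at scale `δ` are controlled by the level `t`. -/
def TestBound (μ : Measure X) (δ f : X → ℝ) (t : ℝ) : Prop :=
  ∀ y, 0 < δ y → ∀ (ψ : X → ℝ) (b : ℝ), 0 ≤ b → (∀ x, |ψ x| ≤ b) →
    (∀ x x', |ψ x - ψ x'| ≤ b * dist x x' / δ y) → (∀ x, ψ x ≠ 0 → dist x y < 2 * δ y) →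
    |∫ x, ψ x * f x ∂μ| ≤ t * δ y ^ 2 * b

/-- `h` is Lipschitz with constant `L / δ` at scale `δ`. -/
def LipAtScale (δ h : X → ℝ) (L : ℝ) : Prop :=
  ∀ x x' y, 0 < δ y → dist x y ≤ 4 * δ y → dist x' y ≤ 4 * δ y →
    |h x - h x'| ≤ L * dist x x' / δ y

/-! ### Pairing f with a smoothing at a single level. -/

section

variable {f g h : X → ℝ} {L N t : ℝ}

theorem setIntegral_abs_sub_center_le (hμ : IsPlanar μ) (hg : Integrable g μ)
    (hh : Integrable h μ) (hL : 0 ≤ L) (hhL : LipAtScale δ h L) {y : X} (hy : 0 < δ y) :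
    ∫ z in ball y (4 * δ y), |g z - h y| ∂μ ≤
      (∫ z in ball y (4 * δ y), |g z - h z| ∂μ) + 256 * L * δ y ^ 2 := by
  have h1 : Integrable (fun z => |g z - h y|) μ := (hg.sub (integrable_const _)).abs
  have h2 : Integrable (fun z => |g z - h z|) μ := (hg.sub hh).abs
  have h3 : ∫ z in ball y (4 * δ y), |g z - h y| ∂μ ≤
      ∫ z in ball y (4 * δ y), (|g z - h z| + 4 * L) ∂μ := by
    refine setIntegral_mono_on h1.integrableOn (h2.add (integrable_const _)).integrableOn
      measurableSet_ball fun z hz => ?_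
    rw [mem_ball] at hz
    have h4 := hhL z y y hy hz.le (by simpa using hy.le)
    have h5 : L * dist z y / δ y ≤ 4 * L := by
      rw [div_le_iff₀ hy]; nlinarith
    calc |g z - h y| ≤ |g z - h z| + |h z - h y| := abs_sub_le _ _ _
      _ ≤ _ := by linarith
  rw [integral_add h2.integrableOn (integrable_const _)] at h3
  simp only [integral_const, measureReal_restrict_apply_univ, smul_eq_mul] at h3
  have h5 := hμ.upper y (4 * δ y) (by positivity)
  have h6 : μ.real (ball y (4 * δ y)) * (4 * L) ≤ 4 * (4 * δ y) ^ 2 * (4 * L) := by gcongr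
  linarith

/-- The function ψ(x) = K(x, y) (G x - h x) is an admissible bump at scale δ y of height about w / δ
y², where w is the local mean of |g - h| plus L. Freezing h at y lets the smoothing estimates for
`g` minus a constant control G - h and its Lipschitz constant by w. -/
theorem abs_integral_tentKernel_smoothing_le (hμ : IsPlanar μ) (hδ : IsScale δ)
    (hg : Integrable g μ) (hh : Integrable h μ) (hL : 0 ≤ L) (hhL : LipAtScale δ h L)
    (hf : TestBound μ δ f t) {y : X} (hy : 0 < δ y) :
    |∫ x, tentKernel μ δ x y * (f x * (smoothing μ δ g x - h x)) ∂μ| ≤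
      t * (10 ^ 14 * ((∫ z in ball y (4 * δ y), |g z - h z| ∂μ) / δ y ^ 2 + L)) := by
  set G := smoothing μ δ g
  set I := ∫ z in ball y (4 * δ y), |g z - h z| ∂μ
  have hI0 : 0 ≤ I := integral_nonneg fun _ => abs_nonneg _
  set w := I / δ y ^ 2 + L with hw
  have hw0 : 0 ≤ w := by positivity
  have hLw : L ≤ w := le_add_of_nonneg_left (by positivity)
  have hIw : I + 256 * L * δ y ^ 2 ≤ 256 * w * δ y ^ 2 := by
    rw [hw]; field_simp; nlinarith
  have hc : ∫ z in ball y ((2 + 2) * δ y), |g z - h y| ∂μ ≤ 256 * w * δ y ^ 2 := by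
    have := setIntegral_abs_sub_center_le hμ hg hh hL hhL hy
    norm_num
    linarith
  have hF : ∀ x, dist x y ≤ 2 * δ y → |G x - h x| ≤ 10 ^ 5 * w := by
    intro x hx
    have h1 := abs_smoothing_sub_const_le hμ hδ hg hy (by norm_num : (2 : ℝ) ≤ 4) hx (h y)
    have h2 := hhL y x y hy (by simpa using hy.le) (by linarith)
    have h3 : 384 / δ y ^ 2 * (256 * w * δ y ^ 2) = 98304 * w := by field_simp; ring
    have h4 : L * dist y x / δ y ≤ 2 * w := by
      rw [div_le_iff₀ hy, dist_comm]
      calc L * dist x y ≤ w * (2 * δ y) := by gcongr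
        _ = _ := by ring
    calc |G x - h x| ≤ |G x - h y| + |h y - h x| := abs_sub_le _ _ _
      _ ≤ 98304 * w + 2 * w := by
          refine add_le_add (h1.trans ?_) (h2.trans h4)
          rw [← h3]; gcongr
      _ ≤ _ := by linarith
  have hF' : ∀ x x', dist x y ≤ 2 * δ y → dist x' y ≤ 2 * δ y →
      |(G x - h x) - (G x' - h x')| ≤ 3 * 10 ^ 10 * w * dist x x' / δ y := by
    intro x x' hx hx'
    have h1 := abs_smoothing_sub_le hμ hδ hg hy (by norm_num : (2 : ℝ) ≤ 4) hx hx' (h y)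
    have h2 := hhL x x' y hy (by linarith) (by linarith)
    calc |(G x - h x) - (G x' - h x')| = |(G x - G x') - (h x - h x')| := by congr 1; ring
      _ ≤ |G x - G x'| + |h x - h x'| := abs_sub _ _
      _ ≤ 10 ^ 8 * dist x x' / δ y ^ 3 * (256 * w * δ y ^ 2) + w * dist x x' / δ y := by
          refine add_le_add (h1.trans ?_) (h2.trans ?_) <;> gcongr
      _ = 25600000001 * w * dist x x' / δ y := by field_simp; ring
      _ ≤ _ := by gcongr; norm_num
  set ψ := fun x => tentKernel μ δ x y * (G x - h x) with hψ
  set b := 10 ^ 14 * w / δ y ^ 2 with hb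
  have hsupp : ∀ x, ψ x ≠ 0 → dist x y < 3 / 2 * δ y := fun x hx =>
    (dist_lt_two_of_tentKernel_ne_zero hδ (left_ne_zero_of_mul hx)).2
  have hψs : ∀ x, |ψ x| ≤ 384 * 10 ^ 5 * w / δ y ^ 2 := by
    intro x
    by_cases hx : ψ x = 0
    · rw [hx, abs_zero]; positivity
    · have h1 := hsupp x hx
      rw [hψ, abs_mul, abs_of_nonneg (tentKernel_nonneg x y)]
      calc _ ≤ 384 / δ y ^ 2 * (10 ^ 5 * w) := by
            gcongr
            · exact tentKernel_le hμ hδ hy (by linarith) y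
            · exact hF x (by linarith)
        _ = _ := by ring
  have hψb : ∀ x, |ψ x| ≤ b := fun x => (hψs x).trans (by rw [hb]; gcongr; norm_num)
  -- The support lies within 3/2 δ y, so a point beyond 2 δ y is at least δ y / 2 away from it and
  -- the sup bound already gives the Lipschitz bound.
  have hfar : ∀ x x', ψ x ≠ 0 → 2 * δ y < dist x' y → |ψ x - ψ x'| ≤ b * dist x x' / δ y := by
    intro x x' hx hx'
    have h1 := hsupp x hx
    have h2 : ψ x' = 0 := by
      by_contra h
      linarith [hsupp x' h]
    have h3 := dist_triangle_left x' y x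
    have h4 : δ y ≤ 2 * dist x x' := by linarith
    rw [h2, sub_zero]
    refine (hψs x).trans ?_
    rw [hb, le_div_iff₀ hy]
    calc 384 * 10 ^ 5 * w / δ y ^ 2 * δ y ≤ 384 * 10 ^ 5 * w / δ y ^ 2 * (2 * dist x x') := by
          gcongr
      _ = 76800000 * w / δ y ^ 2 * dist x x' := by ring
      _ ≤ _ := by gcongr; norm_num
  have hψL : ∀ x x', |ψ x - ψ x'| ≤ b * dist x x' / δ y := by
    intro x x'
    by_cases hx : dist x y ≤ 2 * δ y
    · by_cases hx' : dist x' y ≤ 2 * δ y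
      · have e : ψ x - ψ x' = (tentKernel μ δ x y - tentKernel μ δ x' y) * (G x - h x) +
            tentKernel μ δ x' y * ((G x - h x) - (G x' - h x')) := by rw [hψ]; ring
        rw [e]
        refine (abs_add_le _ _).trans ?_
        rw [abs_mul, abs_mul, abs_of_nonneg (tentKernel_nonneg x' y)]
        calc _ ≤ 10 ^ 8 * dist x x' / δ y ^ 3 * (10 ^ 5 * w) +
              384 / δ y ^ 2 * (3 * 10 ^ 10 * w * dist x x' / δ y) := by
              gcongr
              · exact abs_tentKernel_sub_le hμ hδ hy (by linarith) (by linarith) y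
              · exact hF x hx
              · exact tentKernel_le hμ hδ hy (by linarith) y
              · exact hF' x x' hx hx'
          _ = 21520000000000 * w / δ y ^ 2 * dist x x' / δ y := by field_simp; ring
          _ ≤ _ := by rw [hb]; gcongr; norm_num
      · by_cases h0 : ψ x = 0
        · have h1 : ψ x' = 0 := by
            by_contra h
            linarith [hsupp x' h]
          rw [h0, h1, sub_zero, abs_zero]; positivity
        · exact hfar x x' h0 (by linarith)
    · by_cases h0 : ψ x' = 0
      · have h1 : ψ x = 0 := by
          by_contra h
          linarith [hsupp x h]
        rw [h0, h1, sub_zero, abs_zero]; positivity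
      · rw [abs_sub_comm, dist_comm]
        exact hfar x' x h0 (by linarith)
  have key := hf y hy ψ b (by positivity) hψb hψL fun x hx => by linarith [hsupp x hx]
  calc _ = |∫ x, ψ x * f x ∂μ| := by
        congr 2; ext x; rw [hψ]; ring
    _ ≤ t * δ y ^ 2 * b := key
    _ = _ := by rw [hb]; field_simp

/-- Where δ vanishes the smoothing is `g` and |f| ≤ t gives t ∫ |g - h|. Elsewhere the bump estimate
is integrated over the centres y, and Fubini turns the local means of |g - h| back into ∫ |g - h|.
-/
theorem abs_integral_mul_smoothing_sub_le (hμ : IsPlanar μ) (hδ : IsScale δ)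
    (hfi : Integrable f μ) (hg : Measurable g) (hgN : ∀ x, |g x| ≤ N) (hh : Measurable h)
    (hhN : ∀ x, |h x| ≤ N) (hL : 0 ≤ L) (hhL : LipAtScale δ h L) (ht : 0 ≤ t)
    (hf : TestBound μ δ f t) (hft : ∀ᵐ x ∂μ, ¬ 0 < δ x → |f x| ≤ t) :
    |∫ x, f x * (smoothing μ δ g x - h x) ∂μ| ≤
      t * (10 ^ 17 * ((∫ x, |g x - h x| ∂μ) + L * μ.real {x | 0 < δ x})) := by
  have hgi : Integrable g μ := integrable_of_abs_le hg hgN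
  have hhi : Integrable h μ := integrable_of_abs_le hh hhN
  have hO := measurableSet_pos hδ
  set O := {x | 0 < δ x} with hOdef
  set G := smoothing μ δ g
  have hGm : Measurable G := measurable_smoothing hδ hg
  have hGN : ∀ x, |G x| ≤ N := abs_smoothing_le hμ hδ hgN
  have hF : Integrable (fun x => f x * (G x - h x)) μ := by
    refine hfi.mul_bdd (c := N + N) (hGm.sub hh).aestronglyMeasurable (.of_forall fun x => ?_)
    exact (abs_sub _ _).trans (add_le_add (hGN x) (hhN x))
  have hgh : Integrable (fun x => |g x - h x|) μ := (hgi.sub hhi).abs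
  have hgh0 : 0 ≤ ∫ x, |g x - h x| ∂μ := integral_nonneg fun _ => abs_nonneg _
  have hsplit : ∫ x, f x * (G x - h x) ∂μ =
      (∫ x, O.indicator (fun x => f x * (G x - h x)) x ∂μ) +
        ∫ x in Oᶜ, f x * (G x - h x) ∂μ := by
    rw [integral_indicator hO, integral_add_compl hO hF]
  have hout : |∫ x in Oᶜ, f x * (G x - h x) ∂μ| ≤ t * ∫ x, |g x - h x| ∂μ := by
    rw [← integral_const_mul]
    change ‖∫ x in Oᶜ, f x * (G x - h x) ∂μ‖ ≤ _
    refine (norm_integral_le_of_norm_le (μ := μ.restrict Oᶜ)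
      (hgh.const_mul t).integrableOn ?_).trans
      (setIntegral_le_integral (hgh.const_mul t) (.of_forall fun x => by positivity))
    rw [ae_restrict_iff' hO.compl]
    filter_upwards [hft] with x hx hxO
    have hx0 : ¬ 0 < δ x := hxO
    rw [norm_mul, Real.norm_eq_abs, Real.norm_eq_abs, show G x = g x from smoothing_of_not_pos hx0]
    gcongr
    exact hx hx0
  have hin : |∫ x, O.indicator (fun x => f x * (G x - h x)) x ∂μ| ≤
      t * (10 ^ 14 * (576 * (∫ x, |g x - h x| ∂μ) + L * μ.real O)) := by
    rw [integral_eq_integral_tentKernel hμ hδ (hF.indicator hO)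
      fun x hx => Set.indicator_of_notMem (by exact hx) _]
    have hk := integrable_kernel_mul (measurable_ballKernel hδ) ballKernel_nonneg
      (integrable_ballKernel (μ := μ) hδ) (integral_ballKernel_le hμ hδ) hgh
    have hJ : Integrable (fun y => ∫ z, ballKernel δ z y * |g z - h z| ∂μ) μ :=
      hk.integral_prod_right
    have hJle : ∫ y, ∫ z, ballKernel δ z y * |g z - h z| ∂μ ∂μ ≤ 576 * ∫ x, |g x - h x| ∂μ := by
      rw [← integral_integral_swap hk, ← integral_const_mul]
      refine integral_mono hk.integral_prod_left (hgh.const_mul _) fun z => ?_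
      simp only [integral_mul_const]
      exact mul_le_mul_of_nonneg_right (integral_ballKernel_le hμ hδ z) (abs_nonneg _)
    have hLi : Integrable (O.indicator fun _ => L) μ := (integrable_const L).indicator hO
    have hb : ∀ y, ‖∫ x, tentKernel μ δ x y * O.indicator (fun x => f x * (G x - h x)) x ∂μ‖ ≤
        t * (10 ^ 14 * ((∫ z, ballKernel δ z y * |g z - h z| ∂μ) +
          O.indicator (fun _ => L) y)) := by
      intro y
      have e : ∀ x, tentKernel μ δ x y * O.indicator (fun x => f x * (G x - h x)) x =
          tentKernel μ δ x y * (f x * (G x - h x)) := by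
        intro x
        by_cases hx : x ∈ O
        · rw [Set.indicator_of_mem hx]
        · rw [tentKernel_eq_zero hx, zero_mul, zero_mul]
      simp only [e]
      by_cases hy : 0 < δ y
      · rw [Set.indicator_of_mem (by exact hy), integral_ballKernel_mul]
        exact abs_integral_tentKernel_smoothing_le hμ hδ hgi hhi hL hhL hf hy
      · rw [Set.indicator_of_notMem (by exact hy), add_zero, integral_eq_zero_of_ae]
        · rw [norm_zero]
          have : 0 ≤ ∫ z, ballKernel δ z y * |g z - h z| ∂μ :=
            integral_nonneg fun z => mul_nonneg (ballKernel_nonneg z y) (abs_nonneg _)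
          positivity
        · refine .of_forall fun x => ?_
          by_contra h0
          exact hy (dist_lt_two_of_tentKernel_ne_zero hδ (left_ne_zero_of_mul h0)).1
    change ‖∫ y, ∫ x, tentKernel μ δ x y * O.indicator (fun x => f x * (G x - h x)) x ∂μ ∂μ‖ ≤ _
    refine (norm_integral_le_of_norm_le (((hJ.add hLi).const_mul (10 ^ 14)).const_mul t)
      (.of_forall hb)).trans ?_
    simp only [integral_const_mul]
    gcongr
    rw [integral_add' hJ hLi, integral_indicator hO]
    simp only [integral_const, measureReal_restrict_apply_univ, smul_eq_mul]
    rw [mul_comm L]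
    gcongr
  have hLO : 0 ≤ L * μ.real O := by positivity
  rw [hsplit]
  calc _ ≤ t * (10 ^ 14 * (576 * (∫ x, |g x - h x| ∂μ) + L * μ.real O)) +
        t * ∫ x, |g x - h x| ∂μ := (abs_add_le _ _).trans (add_le_add hin hout)
    _ = t * (57600000000000001 * (∫ x, |g x - h x| ∂μ) + 10 ^ 14 * (L * μ.real O)) := by ring
    _ ≤ _ := by gcongr; linarith

end

/-! ### Maximal functions in the abstract and the pointwise bound for f. -/

/-- `M` dominates the averages of `f` against Lipschitz bumps of radius at most `1 / 4`. -/
structure IsMaximalBound (μ : Measure X) (f : X → ℝ) (M : X → ENNReal) : Prop where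
  isOpen : ∀ t, IsOpen {x | t < M x}
  test : ∀ z r, 0 < r → r ≤ 1 / 4 → ∀ ψ : X → ℝ, (∀ x, |ψ x| ≤ 1) →
    (∀ x x', |ψ x - ψ x'| ≤ dist x x' / r) → (∀ x, ψ x ≠ 0 → dist x z ≤ r) →
    ENNReal.ofReal |∫ x, ψ x * f x ∂μ| ≤ ENNReal.ofReal (r ^ 2) * M z

theorem IsPlanar.closedBall_le (hμ : IsPlanar μ) (x : X) {r : ℝ} (hr : 0 < r) :
    μ.real (closedBall x r) ≤ 16 * r ^ 2 := by
  calc μ.real (closedBall x r) ≤ μ.real (ball x (2 * r)) :=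
        measureReal_mono (closedBall_subset_ball (by linarith))
    _ ≤ 4 * (2 * r) ^ 2 := hμ.upper x (2 * r) (by positivity)
    _ = _ := by ring

/-- Doubling is what the Lebesgue differentiation theorem requires below. -/
theorem IsPlanar.isUnifLocDoublingMeasure (hμ : IsPlanar μ) : IsUnifLocDoublingMeasure μ := by
  refine ⟨256, ?_⟩
  filter_upwards [Ioc_mem_nhdsGT (zero_lt_one' ℝ)] with r hr x
  have h1 := hμ.closedBall_le x (r := 2 * r) (by linarith [hr.1])
  have h2 := hμ.lower x r hr.1 hr.2
  have h3 : μ.real (ball x r) ≤ μ.real (closedBall x r) := measureReal_mono ball_subset_closedBall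
  have h4 : μ.real (closedBall x (2 * r)) ≤ 256 * μ.real (closedBall x r) := by linarith
  rw [← ofReal_measureReal, ← ofReal_measureReal]
  refine (ENNReal.ofReal_le_ofReal h4).trans (le_of_eq ?_)
  rw [ENNReal.ofReal_mul (by norm_num)]
  norm_num

theorem isScale_const {r : ℝ} (h0 : 0 ≤ r) (h1 : r ≤ 1) : IsScale fun _ : X => r :=
  ⟨fun _ => h0, fun _ => h1, fun x y => by linarith [dist_nonneg (x := x) (y := y)]⟩

/-- Test `f` against the tent at `x` of radius r, normalised to height one: its mass is at least
r²/32, and replacing f by f x costs the mean of |f - f x|, which tends to zero at Lebesgue points.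
-/
theorem IsMaximalBound.abs_le_add (hμ : IsPlanar μ) {f : X → ℝ} {M : X → ENNReal}
    (hf : Integrable f μ) (hM : IsMaximalBound μ f M) {x : X} (hx : M x ≠ ⊤) {r : ℝ} (hr : 0 < r)
    (hr4 : r ≤ 1 / 4) :
    |f x| ≤ 32 * (M x).toReal + 512 * ⨍ y in closedBall x r, ‖f y - f x‖ ∂μ := by
  have hs : IsScale fun _ : X => r := isScale_const hr.le (by linarith)
  set ψ : X → ℝ := fun y => tent (fun _ => r) x y / r with hψ
  have hψ0 : ∀ y, 0 ≤ ψ y := fun y => div_nonneg (tent_nonneg x y) hr.le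
  have hψ1 : ∀ y, |ψ y| ≤ 1 := fun y => by
    rw [abs_of_nonneg (hψ0 y), hψ]
    exact (div_le_one hr).2 (tent_le hs x y)
  have hψs : ∀ y, ψ y ≠ 0 → y ∈ closedBall x r := fun y hy => by
    have h : tent (fun _ => r) x y ≠ 0 := fun h => hy (by rw [hψ]; simp [h])
    have := dist_lt_of_tent_ne_zero h
    rw [mem_closedBall, dist_comm]
    exact this.le
  have hψL : ∀ y y', |ψ y - ψ y'| ≤ dist y y' / r := fun y y' => by
    rw [hψ, ← sub_div, abs_div, abs_of_pos hr]
    gcongr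
    refine (abs_max_sub_max_le_max _ _ _ _).trans ?_
    rw [sub_self, abs_zero, sub_sub_sub_cancel_left, dist_comm x, dist_comm x, abs_sub_comm]
    exact max_le dist_nonneg (abs_dist_sub_le _ _ _)
  have hψi : Integrable ψ μ := (integrable_tent hs x).div_const r
  have h1 := hM.test x r hr hr4 ψ hψ1 hψL hψs
  have h2 : |∫ y, ψ y * f y ∂μ| ≤ r ^ 2 * (M x).toReal := by
    rw [← ENNReal.ofReal_toReal hx, ← ENNReal.ofReal_mul (by positivity)] at h1
    exact (ENNReal.ofReal_le_ofReal_iff (by positivity)).1 h1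
  have h3 := abs_integral_mul_le_of_support measurableSet_closedBall
    (hf.sub (integrable_const (f x))) hψ1 hψs
  rw [one_mul] at h3
  simp only [Pi.sub_apply] at h3
  have hψf : Integrable (fun y => ψ y * f y) μ :=
    hf.bdd_mul (c := 1) hψi.aestronglyMeasurable (.of_forall hψ1)
  have h4 : ∫ y, ψ y * (f y - f x) ∂μ = (∫ y, ψ y * f y ∂μ) - (∫ y, ψ y ∂μ) * f x := by
    simp only [mul_sub]
    rw [integral_sub hψf (hψi.mul_const _), integral_mul_const]
  have h5 : r ^ 2 / 32 ≤ ∫ y, ψ y ∂μ := by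
    rw [hψ, integral_div, le_div_iff₀ hr]
    calc r ^ 2 / 32 * r = r ^ 3 / 32 := by ring
      _ ≤ _ := le_integral_tent hμ hs x
  have h6 : ∫ y in closedBall x r, |f y - f x| ∂μ ≤
      16 * r ^ 2 * ⨍ y in closedBall x r, ‖f y - f x‖ ∂μ := by
    rw [← measure_smul_setAverage _ (measure_ne_top _ _), smul_eq_mul]
    refine mul_le_mul_of_nonneg_right (hμ.closedBall_le x hr) ?_
    rw [setAverage_eq]
    exact smul_nonneg (by positivity) (integral_nonneg fun _ => abs_nonneg _)
  set a := ⨍ y in closedBall x r, ‖f y - f x‖ ∂μ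
  have h7 : r ^ 2 / 32 * |f x| ≤ r ^ 2 * (M x).toReal + 16 * r ^ 2 * a := by
    calc r ^ 2 / 32 * |f x| ≤ (∫ y, ψ y ∂μ) * |f x| := by gcongr
      _ = |(∫ y, ψ y * f y ∂μ) - ∫ y, ψ y * (f y - f x) ∂μ| := by
          rw [h4, sub_sub_cancel, abs_mul, abs_of_nonneg (integral_nonneg hψ0)]
      _ ≤ _ := (abs_sub _ _).trans (by linarith)
  have h8 : r ^ 2 * |f x| ≤ r ^ 2 * (32 * (M x).toReal + 512 * a) := by linarith
  exact le_of_mul_le_mul_left h8 (by positivity)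

theorem IsMaximalBound.ae_abs_le (hμ : IsPlanar μ) {f : X → ℝ} {M : X → ENNReal}
    (hf : Integrable f μ) (hM : IsMaximalBound μ f M) :
    ∀ᵐ x ∂μ, M x ≠ ⊤ → |f x| ≤ 32 * (M x).toReal := by
  have := hμ.isUnifLocDoublingMeasure
  filter_upwards [IsUnifLocDoublingMeasure.ae_tendsto_average_norm_sub μ hf.locallyIntegrable 1]
    with x hx hxM
  have h1 := hx (l := 𝓝[>] (0 : ℝ)) (fun _ => x) id tendsto_id (by
    filter_upwards [self_mem_nhdsWithin] with r hr
    rw [one_mul]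
    exact mem_closedBall_self (le_of_lt hr))
  have h2 : Tendsto (fun r : ℝ => 32 * (M x).toReal +
      512 * ⨍ y in closedBall x (id r), ‖f y - f x‖ ∂μ) (𝓝[>] 0) (𝓝 (32 * (M x).toReal + 512 * 0)) :=
    (h1.const_mul 512).const_add _
  rw [mul_zero, add_zero] at h2
  refine ge_of_tendsto h2 ?_
  filter_upwards [Ioc_mem_nhdsGT (show (0 : ℝ) < 1 / 4 by norm_num)] with r hr
  exact hM.abs_le_add hμ hf hxM hr.1 hr.2

/-- An eighth of the distance to the sublevel set `{M ≤ t}`. -/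
noncomputable def levelScale (M : X → ENNReal) (t : ℝ) (x : X) : ℝ :=
  infDist x {x | M x ≤ ENNReal.ofReal t} / 8

/-! ### Scales attached to the level sets of the maximal function. -/

section LevelScale

variable {f : X → ℝ} {M : X → ENNReal} {t t' : ℝ}

theorem levelScale_pos_iff (hM : IsMaximalBound μ f M)
    (hne : {x | M x ≤ ENNReal.ofReal t}.Nonempty) (x : X) :
    0 < levelScale M t x ↔ ENNReal.ofReal t < M x := by
  have hc : IsClosed {x | M x ≤ ENNReal.ofReal t} := by
    have := (hM.isOpen (ENNReal.ofReal t)).isClosed_compl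
    convert this using 1
    ext; simp
  rw [levelScale, div_pos_iff_of_pos_right (by norm_num), ← hc.notMem_iff_infDist_pos hne]
  simp

theorem levelScale_anti (hne : {x | M x ≤ ENNReal.ofReal t}.Nonempty) (htt' : t ≤ t') (x : X) :
    levelScale M t' x ≤ levelScale M t x := by
  unfold levelScale
  gcongr
  exact infDist_le_infDist_of_subset
    (fun x hx => le_trans hx (ENNReal.ofReal_le_ofReal htt')) hne

/-- A ball of radius 1/8 has measure at least (1/8)²/4 = 1/256, so it cannot fit inside the
superlevel set. -/
theorem exists_dist_lt_of_measure_small (hμ : IsPlanar μ)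
    (hs : μ.real {x | ENNReal.ofReal t < M x} < 1 / 256) (x : X) :
    ∃ y, M y ≤ ENNReal.ofReal t ∧ dist x y < 1 / 8 := by
  by_contra! h
  have h1 : ball x (1 / 8) ⊆ {x | ENNReal.ofReal t < M x} := by
    intro y hy
    by_contra h2
    rw [mem_ball, dist_comm] at hy
    exact (h y (not_lt.1 h2)).not_gt hy
  have h2 := hμ.lower x (1 / 8) (by norm_num) (by norm_num)
  have h3 : μ.real (ball x (1 / 8)) ≤ μ.real {x | ENNReal.ofReal t < M x} := measureReal_mono h1
  norm_num at *
  linarith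

theorem levelScale_le (hμ : IsPlanar μ)
    (hs : μ.real {x | ENNReal.ofReal t < M x} < 1 / 256) (x : X) :
    levelScale M t x ≤ 1 / 64 := by
  obtain ⟨y, hy, hxy⟩ := exists_dist_lt_of_measure_small hμ hs x
  have : infDist x {x | M x ≤ ENNReal.ofReal t} ≤ dist x y := infDist_le_dist_of_mem hy
  unfold levelScale
  linarith

theorem isScale_levelScale (hμ : IsPlanar μ)
    (hs : μ.real {x | ENNReal.ofReal t < M x} < 1 / 256) : IsScale (levelScale M t) where
  nonneg x := div_nonneg infDist_nonneg (by norm_num)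
  le_one x := (levelScale_le hμ hs x).trans (by norm_num)
  lip x y := by
    have : infDist x {x | M x ≤ ENNReal.ofReal t} ≤
      infDist y {x | M x ≤ ENNReal.ofReal t} + dist x y := infDist_le_infDist_add_dist
    unfold levelScale
    linarith

theorem IsMaximalBound.testBound (hμ : IsPlanar μ) (hM : IsMaximalBound μ f M) (ht : 0 ≤ t)
    (hs : μ.real {x | ENNReal.ofReal t < M x} < 1 / 256) :
    TestBound μ (levelScale M t) f (4096 * t) := by
  intro y hy ψ b hb hψb hψL hψs
  rcases hb.eq_or_lt with rfl | hb
  · have : ∀ x, ψ x = 0 := fun x => abs_nonpos_iff.1 (hψb x)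
    simp [this]
  have hne : {x | M x ≤ ENNReal.ofReal t}.Nonempty :=
    (exists_dist_lt_of_measure_small hμ hs y).imp fun _ h => h.1
  have hd : infDist y {x | M x ≤ ENNReal.ofReal t} = 8 * levelScale M t y := by
    unfold levelScale; ring
  have h64 := levelScale_le hμ hs y
  set d := levelScale M t y
  -- The sublevel set is at distance exactly 8d, so some `z` in it lies within 9d. A bump within 2d
  -- of `y` is then within 11d ≤ 16d of `z`, and 16d ≤ 1/4 is an admissible radius; division by 16b
  -- normalises the height and the Lipschitz constant.
  obtain ⟨z, hz, hyz⟩ := (infDist_lt_iff hne).1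
    (show infDist y {x | M x ≤ ENNReal.ofReal t} < 9 * d by linarith)
  have h1 := hM.test z (16 * d) (by positivity) (by linarith) (fun x => ψ x / (16 * b))
    (fun x => by
      rw [abs_div, abs_of_pos (show 0 < 16 * b by positivity), div_le_one (by positivity)]
      linarith [hψb x])
    (fun x x' => by
      rw [← sub_div, abs_div, abs_of_pos (show 0 < 16 * b by positivity)]
      calc |ψ x - ψ x'| / (16 * b) ≤ b * dist x x' / d / (16 * b) := by
            gcongr
            exact hψL x x'
        _ = _ := by field_simp)
    (fun x hx => by
      have h2 := hψs x fun h => hx (by rw [h, zero_div])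
      have h3 := dist_triangle x y z
      linarith)
  have h2 : |∫ x, ψ x / (16 * b) * f x ∂μ| ≤ (16 * d) ^ 2 * t := by
    rw [← ENNReal.ofReal_le_ofReal_iff (by positivity), ENNReal.ofReal_mul (by positivity)]
    exact h1.trans (by gcongr; exact hz)
  have e : ∫ x, ψ x * f x ∂μ = 16 * b * ∫ x, ψ x / (16 * b) * f x ∂μ := by
    rw [← integral_const_mul]
    congr 1; ext x; field_simp
  rw [e, abs_mul, abs_of_pos (show 0 < 16 * b by positivity)]
  calc _ ≤ 16 * b * ((16 * d) ^ 2 * t) := by gcongr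
    _ = _ := by ring

end LevelScale

/-! ### Summation over dyadic levels and the duality estimate. -/

/-- A geometric sum is dominated by twice its last term; with m = M(x), integration gives Σ t_k
|O_k| ≤ 2 ∫ M. -/
theorem sum_dyadic_levels_le {a m : ℝ} (ha : 0 < a) (hm : 0 ≤ m) (n : ℕ) :
    ∑ k ∈ Finset.range n, (if 2 ^ k * a < m then 2 ^ k * a else 0) ≤ 2 * m := by
  have h : ∀ n : ℕ, ∑ k ∈ Finset.range n, (if 2 ^ k * a < m then 2 ^ k * a else 0) ≤ 2 ^ n * a := by
    intro n
    induction n with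
    | zero => simpa using ha.le
    | succ n ih =>
      rw [Finset.sum_range_succ, pow_succ]
      have : 0 < 2 ^ n * a := by positivity
      split_ifs <;> linarith
  induction n with
  | zero => simpa using hm
  | succ n ih =>
    rw [Finset.sum_range_succ]
    split_ifs with hn
    · linarith [h n]
    · linarith

section

variable {f g : X → ℝ} {M : X → ENNReal}

theorem IsMaximalBound.measurable (hM : IsMaximalBound μ f M) : Measurable M :=
  measurable_of_Ioi fun t => (hM.isOpen t).measurableSet

theorem IsMaximalBound.sum_mul_measure_le (hM : IsMaximalBound μ f M) (hfin : ∫⁻ x, M x ∂μ ≠ ⊤)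
    {a : ℝ} (ha : 0 < a) (n : ℕ) :
    ∑ k ∈ Finset.range n, 2 ^ k * a * μ.real {x | ENNReal.ofReal (2 ^ k * a) < M x} ≤
      2 * (∫⁻ x, M x ∂μ).toReal := by
  have hMm := hM.measurable
  have hmi := integrable_toReal_of_lintegral_ne_top hMm.aemeasurable hfin
  have htop := ae_lt_top hMm hfin
  rw [← integral_toReal hMm.aemeasurable htop, ← integral_const_mul]
  have hms (k : ℕ) : MeasurableSet {x | ENNReal.ofReal (2 ^ k * a) < M x} :=
    (hM.isOpen _).measurableSet
  have e : ∑ k ∈ Finset.range n, 2 ^ k * a * μ.real {x | ENNReal.ofReal (2 ^ k * a) < M x} =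
      ∫ x, ∑ k ∈ Finset.range n,
        {x | ENNReal.ofReal (2 ^ k * a) < M x}.indicator (fun _ => 2 ^ k * a) x ∂μ := by
    rw [integral_finsetSum _ fun k _ => (integrable_const _).indicator (hms k)]
    refine Finset.sum_congr rfl fun k _ => ?_
    rw [integral_indicator (hms k)]
    simp [mul_comm]
  rw [e]
  refine integral_mono_ae (integrable_finsetSum _ fun k _ => (integrable_const _).indicator (hms k))
    (hmi.const_mul 2) ?_
  filter_upwards [htop] with x hx
  refine le_trans (Finset.sum_le_sum fun k _ => le_of_eq ?_)
    (sum_dyadic_levels_le ha (ENNReal.toReal_nonneg (a := M x)) n)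
  have hiff : ENNReal.ofReal (2 ^ k * a) < M x ↔ 2 ^ k * a < (M x).toReal :=
    ENNReal.ofReal_lt_iff_lt_toReal (by positivity) hx.ne
  simp only [Set.indicator_apply, Set.mem_ofPred_eq, hiff]

theorem IsMaximalBound.abs_integral_smoothing_sub_le (hμ : IsPlanar μ) (hf : Integrable f μ)
    (hM : IsMaximalBound μ f M) (htop : ∀ᵐ x ∂μ, M x ≠ ⊤) {h : X → ℝ} {t L N : ℝ} (ht : 0 ≤ t)
    (hs : μ.real {x | ENNReal.ofReal t < M x} < 1 / 256)
    (hg : Measurable g) (hgN : ∀ x, |g x| ≤ N) (hh : Measurable h) (hhN : ∀ x, |h x| ≤ N)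
    (hL : 0 ≤ L) (hhL : LipAtScale (levelScale M t) h L) :
    |∫ x, f x * (smoothing μ (levelScale M t) g x - h x) ∂μ| ≤ 4096 * t *
      (10 ^ 17 * ((∫ x, |g x - h x| ∂μ) + L * μ.real {x | ENNReal.ofReal t < M x})) := by
  rcases isEmpty_or_nonempty X with hX | ⟨⟨x₀⟩⟩
  · simp [integral_of_isEmpty, Set.eq_empty_of_isEmpty]
  have hne : {x | M x ≤ ENNReal.ofReal t}.Nonempty :=
    (exists_dist_lt_of_measure_small hμ hs x₀).imp fun _ h => h.1
  have hiff := levelScale_pos_iff hM hne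
  have e : {x | 0 < levelScale M t x} = {x | ENNReal.ofReal t < M x} := Set.ext hiff
  rw [← e]
  refine abs_integral_mul_smoothing_sub_le hμ (isScale_levelScale hμ hs) hf hg hgN hh hhN hL hhL
    (by positivity) (hM.testBound hμ ht hs) ?_
  filter_upwards [hM.ae_abs_le hμ hf, htop] with x hx hx' hx0
  rw [hiff, not_lt] at hx0
  have h1 : (M x).toReal ≤ t := ENNReal.toReal_le_of_le_ofReal ht hx0
  linarith [hx hx']

theorem IsMaximalBound.abs_integral_le_of_bounded (hμ : IsPlanar μ) (hf : Integrable f μ)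
    (hM : IsMaximalBound μ f M) (hfin : ∫⁻ x, M x ∂μ ≠ ⊤) {A N c : ℝ}
    (hg : Measurable g) (hgN : ∀ x, |g x| ≤ N) (hcN : |c| ≤ N) (hA : HasOscillation μ g A)
    (hc : ∫ x, |g x - c| ∂μ ≤ A) :
    |∫ x, f x * (g x - c) ∂μ| ≤ 10 ^ 32 * (∫⁻ x, M x ∂μ).toReal * A := by
  set I := (∫⁻ x, M x ∂μ).toReal with hI
  have hI0 : 0 ≤ I := ENNReal.toReal_nonneg
  have hA0 : 0 ≤ A := le_trans (integral_nonneg fun _ => abs_nonneg _) hc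
  have hMm := hM.measurable
  have htop : ∀ᵐ x ∂μ, M x ≠ ⊤ := (ae_lt_top hMm hfin).mono fun _ h => h.ne
  rcases hI0.eq_or_lt with hI1 | hI1
  -- Here all the levels would be zero; instead M = 0 almost everywhere forces f = 0 almost
  -- everywhere.
  · have h0 : ∫⁻ x, M x ∂μ = 0 := by
      rcases (ENNReal.toReal_eq_zero_iff _).1 (hI.symm.trans hI1.symm) with h | h
      · exact h
      · exact absurd h hfin
    rw [lintegral_eq_zero_iff hMm] at h0
    have hf0 : ∀ᵐ x ∂μ, f x * (g x - c) = 0 := by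
      filter_upwards [h0, hM.ae_abs_le hμ hf] with x hx hx'
      rw [hx] at hx'
      have := hx' (by simp)
      simp only [Pi.zero_apply, ENNReal.toReal_zero, mul_zero, abs_nonpos_iff] at this
      rw [this, zero_mul]
    rw [integral_eq_zero_of_ae hf0, abs_zero, ← hI1]
    simp
  -- The one-term case of the dyadic sum gives a |O_0| ≤ 2 I, hence |O_0| ≤ 1/512 < 1/256, as the
  -- level scales require.
  set a := 1024 * I with ha
  have ha0 : 0 < a := by positivity
  set t : ℕ → ℝ := fun k => 2 ^ k * a with ht
  have ht0 (k : ℕ) : 0 ≤ t k := by positivity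
  have htm (k : ℕ) : t k ≤ t (k + 1) := by
    simp only [ht]; gcongr <;> norm_num
  set O : ℕ → Set X := fun k => {x | ENNReal.ofReal (t k) < M x} with hO
  have hOm (k : ℕ) : O (k + 1) ⊆ O k := fun x hx =>
    lt_of_le_of_lt (ENNReal.ofReal_le_ofReal (htm k)) hx
  have hsum : ∀ n, ∑ k ∈ Finset.range n, t k * μ.real (O k) ≤ 2 * I :=
    hM.sum_mul_measure_le hfin ha0
  have hs0 : μ.real (O 0) < 1 / 256 := by
    have := hsum 1
    simp only [Finset.sum_range_one, ht, pow_zero, one_mul, ha] at this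
    nlinarith
  have hs (k : ℕ) : μ.real (O k) < 1 / 256 := by
    induction k with
    | zero => exact hs0
    | succ k ih => exact (measureReal_mono (hOm k)).trans_lt ih
  set G : ℕ → X → ℝ := fun k => smoothing μ (levelScale M (t k)) g with hG
  have hδ (k : ℕ) : IsScale (levelScale M (t k)) := isScale_levelScale hμ (hs k)
  have hGm (k : ℕ) : Measurable (G k) := measurable_smoothing (hδ k) hg
  have hGN (k : ℕ) (x : X) : |G k x| ≤ N := abs_smoothing_le hμ (hδ k) hgN x
  have hgi : Integrable g μ := integrable_of_abs_le hg hgN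
  have hbase : |∫ x, f x * (G 0 x - c) ∂μ| ≤ 10 ^ 24 * (I * A) := by
    have h1 := hM.abs_integral_smoothing_sub_le hμ hf htop (ht0 0) (hs 0) hg hgN
      (h := fun _ => c) measurable_const (fun _ => hcN) le_rfl
      (fun x x' y _ _ _ => by simp)
    refine h1.trans ?_
    simp only [ht, pow_zero, one_mul, zero_mul, add_zero, ha]
    calc _ ≤ 4096 * (1024 * I) * (10 ^ 17 * A) := by gcongr
      _ = 419430400000000000000000 * (I * A) := by ring
      _ ≤ _ := by gcongr; norm_num
  have hstep (k : ℕ) : |∫ x, f x * (G (k + 1) x - G k x) ∂μ| ≤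
      2 * 10 ^ 31 * A * (t k * μ.real (O k)) := by
    have hne : ∀ x : X, {x | M x ≤ ENNReal.ofReal (t k)}.Nonempty := fun x =>
      (exists_dist_lt_of_measure_small hμ (hs k) x).imp fun _ h => h.1
    -- The scale decreases with the level, so the Lipschitz bound of `G k` at its own scale persists
    -- at the finer scale of level k + 1.
    have hL : LipAtScale (levelScale M (t (k + 1))) (G k) (10 ^ 10 * A) := by
      intro x x' y hy hx hx'
      have h1 := levelScale_anti (hne x) (htm k) y
      refine (hA.abs_smoothing_sub_le hμ (hδ k) hgi (hy.trans_le h1) (by linarith)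
        (by linarith)).trans ?_
      gcongr
    have h1 := hM.abs_integral_smoothing_sub_le hμ hf htop (ht0 (k + 1)) (hs (k + 1)) hg hgN
      (hGm k) (hGN k) (by positivity) hL
    have h2 := hA.integral_abs_sub_smoothing_le hμ (hδ k) hg hgN
    have e : μ.real {x | 0 < levelScale M (t k) x} = μ.real (O k) := by
      congr 1
      ext x
      exact levelScale_pos_iff hM (hne x) x
    rw [e] at h2
    have h3 : μ.real (O (k + 1)) ≤ μ.real (O k) := measureReal_mono (hOm k)
    have h4 : t (k + 1) = 2 * t k := by simp only [ht]; ring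
    calc _ ≤ 4096 * t (k + 1) * (10 ^ 17 * (10 ^ 8 * A * μ.real (O k) +
          10 ^ 10 * A * μ.real (O k))) := by
          refine h1.trans ?_
          have := ht0 (k + 1)
          gcongr
      _ = 8273920000000000000000000000000 * A * (t k * μ.real (O k)) := by rw [h4]; ring
      _ ≤ _ := by
          have := ht0 k
          gcongr
          norm_num
  have hint {p q : X → ℝ} (hp : Measurable p) (hq : Measurable q) (hpN : ∀ x, |p x| ≤ N)
      (hqN : ∀ x, |q x| ≤ N) : Integrable (fun x => f x * (p x - q x)) μ := by
    refine hf.mul_bdd (c := N + N) (hp.sub hq).aestronglyMeasurable (.of_forall fun x => ?_)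
    exact (abs_sub _ _).trans (add_le_add (hpN x) (hqN x))
  have htel (n : ℕ) : |∫ x, f x * (G n x - c) ∂μ| ≤
      10 ^ 24 * (I * A) + 2 * 10 ^ 31 * A * ∑ k ∈ Finset.range n, t k * μ.real (O k) := by
    induction n with
    | zero => simpa using hbase
    | succ n ih =>
      have e : ∫ x, f x * (G (n + 1) x - c) ∂μ =
          (∫ x, f x * (G n x - c) ∂μ) + ∫ x, f x * (G (n + 1) x - G n x) ∂μ := by
        rw [← integral_add (hint (hGm n) measurable_const (hGN n) fun _ => hcN)
          (hint (hGm (n + 1)) (hGm n) (hGN (n + 1)) (hGN n))]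
        congr 1; ext x; ring
      rw [e, Finset.sum_range_succ]
      refine (abs_add_le _ _).trans ?_
      linarith [hstep n]
  have hlim : Tendsto (fun n => ∫ x, f x * (G n x - c) ∂μ) atTop
      (𝓝 (∫ x, f x * (g x - c) ∂μ)) := by
    refine tendsto_integral_of_dominated_convergence (fun x => |f x| * (N + N))
      (fun n => (hint (hGm n) measurable_const (hGN n) fun _ => hcN).aestronglyMeasurable)
      (hf.abs.mul_const _) (fun n => .of_forall fun x => ?_) ?_
    · rw [norm_mul]
      exact mul_le_mul_of_nonneg_left ((abs_sub _ _).trans (add_le_add (hGN n x) hcN))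
        (abs_nonneg _)
    -- Once t n exceeds M x, the scale vanishes at x and `G n x` equals `g x`: the sequence is
    -- eventually constant.
    · filter_upwards [htop] with x hx
      have h1 : Tendsto t atTop atTop :=
        (tendsto_pow_atTop_atTop_of_one_lt one_lt_two).atTop_mul_const ha0
      refine tendsto_const_nhds.congr' ?_
      filter_upwards [h1.eventually_ge_atTop (M x).toReal] with n hn
      have h2 : M x ≤ ENNReal.ofReal (t n) := (ENNReal.le_ofReal_iff_toReal_le hx (ht0 n)).2 hn
      have h3 : ¬ 0 < levelScale M (t n) x := by
        rw [levelScale_pos_iff hM ⟨x, h2⟩]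
        exact h2.not_gt
      rw [hG]
      simp only [smoothing_of_not_pos h3]
  refine le_of_tendsto hlim.abs (.of_forall fun n => (htel n).trans ?_)
  calc _ ≤ 10 ^ 24 * (I * A) + 2 * 10 ^ 31 * A * (2 * I) := by
        gcongr
        exact hsum n
    _ = (10 ^ 24 + 4 * 10 ^ 31) * (I * A) := by ring
    _ ≤ 10 ^ 32 * (I * A) := by gcongr; norm_num
    _ = _ := by ring

/-! ### Removal of the boundedness and measurability assumptions on g. -/

/-- Truncation at height `N`. -/
def truncate (N s : ℝ) : ℝ := max (-N) (min s N)

theorem abs_truncate_le {N : ℝ} (hN : 0 ≤ N) (s : ℝ) : |truncate N s| ≤ N :=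
  abs_le.2 ⟨le_max_left _ _, max_le (by linarith) (min_le_right _ _)⟩

theorem abs_truncate_sub_le (N s s' : ℝ) : |truncate N s - truncate N s'| ≤ |s - s'| := by
  refine (abs_max_sub_max_le_max _ _ _ _).trans ?_
  rw [sub_self, abs_zero]
  refine max_le (abs_nonneg _) ((abs_min_sub_min_le_max _ _ _ _).trans ?_)
  simp

theorem continuous_truncate (N : ℝ) : Continuous (truncate N) :=
  continuous_const.max (continuous_id.min continuous_const)

theorem truncate_eq {N s : ℝ} (h : |s| ≤ N) : truncate N s = s := by
  rw [abs_le] at h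
  rw [truncate, min_eq_left h.2, max_eq_right h.1]

theorem HasOscillation.truncate {A : ℝ} (hA : HasOscillation μ g A) (hg : Integrable g μ)
    (N : ℝ) : HasOscillation μ (fun x => truncate N (g x)) A := by
  intro y r hr
  obtain ⟨m, hm⟩ := hA y r hr
  refine ⟨TorusDuality.truncate N m, le_trans ?_ hm⟩
  have hi : Integrable (fun x => |g x - m|) μ := (hg.sub (integrable_const m)).abs
  refine integral_mono_of_nonneg (.of_forall fun _ => abs_nonneg _) hi.integrableOn
    (.of_forall fun x => abs_truncate_sub_le N _ _)

theorem IsMaximalBound.abs_integral_le_of_measurable (hμ : IsPlanar μ) (hf : Integrable f μ)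
    (hM : IsMaximalBound μ f M) (hfin : ∫⁻ x, M x ∂μ ≠ ⊤) {A c : ℝ}
    (hgm : Measurable g) (hg : Integrable g μ) (hfg : Integrable (fun x => f x * g x) μ)
    (hA : HasOscillation μ g A) (hc : ∫ x, |g x - c| ∂μ ≤ A) :
    |∫ x, f x * (g x - c) ∂μ| ≤ 10 ^ 32 * (∫⁻ x, M x ∂μ).toReal * A := by
  have hgc : Integrable (fun x => |g x - c|) μ := (hg.sub (integrable_const c)).abs
  have hlim : Tendsto (fun n : ℕ => ∫ x, f x * (truncate n (g x) - truncate n c) ∂μ) atTop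
      (𝓝 (∫ x, f x * (g x - c) ∂μ)) := by
    -- The integrability of f g supplies the dominating function; truncation is 1-Lipschitz, so it
    -- increases neither the integrand nor the oscillation.
    have hb : Integrable (fun x => |f x * (g x - c)|) μ := by
      refine Integrable.abs ?_
      simp only [mul_sub]
      exact hfg.sub (hf.mul_const c)
    refine tendsto_integral_of_dominated_convergence _ (fun n => ?_) hb
      (fun n => .of_forall fun x => ?_) (.of_forall fun x => ?_)
    · exact hf.aestronglyMeasurable.mul
        (((continuous_truncate n).measurable.comp hgm).sub_const _).aestronglyMeasurable
    · rw [Real.norm_eq_abs, abs_mul, abs_mul]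
      exact mul_le_mul_of_nonneg_left (abs_truncate_sub_le _ _ _) (abs_nonneg _)
    · refine tendsto_const_nhds.congr' ?_
      filter_upwards [eventually_ge_atTop ⌈max |g x| |c|⌉₊] with n hn
      have h1 : max |g x| |c| ≤ n := Nat.ceil_le.1 hn
      rw [truncate_eq (le_of_max_le_left h1), truncate_eq (le_of_max_le_right h1)]
  refine le_of_tendsto hlim.abs (.of_forall fun n => ?_)
  refine hM.abs_integral_le_of_bounded hμ hf hfin ((continuous_truncate n).measurable.comp hgm)
    (fun x => abs_truncate_le n.cast_nonneg _) (abs_truncate_le n.cast_nonneg c)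
    (hA.truncate hg n) (le_trans ?_ hc)
  exact integral_mono_of_nonneg (.of_forall fun _ => abs_nonneg _) hgc
    (.of_forall fun x => abs_truncate_sub_le n _ _)

/-- The duality estimate: the pairing of `f` with `g - c` is controlled by the integral of a
maximal function of `f` and the mean oscillation of `g`. -/
theorem IsMaximalBound.abs_integral_le (hμ : IsPlanar μ) (hf : Integrable f μ)
    (hM : IsMaximalBound μ f M) (hfin : ∫⁻ x, M x ∂μ ≠ ⊤) {A c : ℝ}
    (hg : Integrable g μ) (hfg : Integrable (fun x => f x * g x) μ)
    (hA : HasOscillation μ g A) (hc : ∫ x, |g x - c| ∂μ ≤ A) :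
    |∫ x, f x * (g x - c) ∂μ| ≤ 10 ^ 32 * (∫⁻ x, M x ∂μ).toReal * A := by
  have hae : hg.1.mk g =ᵐ[μ] g := hg.1.ae_eq_mk.symm
  have habs (m : ℝ) : (fun x => |hg.1.mk g x - m|) =ᵐ[μ] fun x => |g x - m| := by
    filter_upwards [hae] with x hx
    rw [hx]
  have e : ∫ x, f x * (g x - c) ∂μ = ∫ x, f x * (hg.1.mk g x - c) ∂μ :=
    integral_congr_ae (by filter_upwards [hae] with x hx; rw [hx])
  rw [e]
  refine hM.abs_integral_le_of_measurable hμ hf hfin hg.1.stronglyMeasurable_mk.measurable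
    (hg.congr hae.symm) (hfg.congr (by filter_upwards [hae] with x hx; rw [hx])) (fun y r hr => ?_)
    ((integral_congr_ae (habs c)).trans_le hc)
  obtain ⟨m, hm⟩ := hA y r hr
  exact ⟨m, (integral_congr_ae (ae_restrict_of_ae (habs m))).trans_le hm⟩

end

end MetricMeasureSpace

/-! ### Mollification of Lipschitz functions. -/

section Mollify

open scoped Convolution

variable {E : Type*} [NormedAddCommGroup E] [NormedSpace ℝ E] [FiniteDimensional ℝ E]
  [HasContDiffBump E] [MeasurableSpace E] [BorelSpace E]

/-- Mollification of a bounded Lipschitz function, keeping the Lipschitz constant and the bound. -/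
theorem exists_contDiff_lipschitzWith_approx (μ : Measure E) [μ.IsAddHaarMeasure] {ψ : E → ℝ}
    {K : NNReal} (hψ : LipschitzWith K ψ) {b : ℝ} (hb : ∀ x, |ψ x| ≤ b) {ε : ℝ} (hε : 0 < ε) :
    ∃ φ : E → ℝ, ContDiff ℝ (⊤ : ℕ∞) φ ∧ LipschitzWith K φ ∧ (∀ x, |φ x| ≤ b) ∧
      (∀ x, |φ x - ψ x| ≤ K * ε) ∧ ∀ x, (∀ y ∈ ball x ε, ψ y = 0) → φ x = 0 := by
  let η : ContDiffBump (0 : E) := ⟨ε / 2, ε, by positivity, by linarith⟩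
  have hη : η.rOut = ε := rfl
  have hi : Integrable (η.normed μ) μ := η.integrable_normed
  have hψm : ∀ x, AEStronglyMeasurable (fun t => ψ (x - t)) μ := fun x =>
    (hψ.continuous.comp (continuous_const.sub continuous_id)).aestronglyMeasurable
  have hint : ∀ x, Integrable (fun t => η.normed μ t * ψ (x - t)) μ := fun x =>
    hi.mul_bdd (c := b) (hψm x) (.of_forall fun t => hb _)
  have hconv : ∀ x, (η.normed μ ⋆[ContinuousLinearMap.lsmul ℝ ℝ, μ] ψ) x =
      ∫ t, η.normed μ t * ψ (x - t) ∂μ := fun x => rfl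
  refine ⟨η.normed μ ⋆[ContinuousLinearMap.lsmul ℝ ℝ, μ] ψ, ?_, ?_, ?_, ?_, ?_⟩
  · exact η.hasCompactSupport_normed.contDiff_convolution_left _ η.contDiff_normed
      hψ.continuous.locallyIntegrable
  · refine LipschitzWith.of_dist_le_mul fun x y => ?_
    rw [dist_eq_norm, hconv, hconv, ← integral_sub (hint x) (hint y)]
    have h1 : ∫ t, η.normed μ t * (K * dist x y) ∂μ = K * dist x y := by
      rw [integral_mul_const, η.integral_normed, one_mul]
    refine (norm_integral_le_of_norm_le (hi.mul_const (K * dist x y))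
      (.of_forall fun t => ?_)).trans h1.le
    rw [← mul_sub, norm_mul, Real.norm_of_nonneg (η.nonneg_normed t)]
    refine mul_le_mul_of_nonneg_left ?_ (η.nonneg_normed t)
    rw [← dist_eq_norm]
    simpa using hψ.dist_le_mul (x - t) (y - t)
  · intro x
    rw [hconv]
    have h1 : ∫ t, η.normed μ t * b ∂μ = b := by
      rw [integral_mul_const, η.integral_normed, one_mul]
    change ‖∫ t, η.normed μ t * ψ (x - t) ∂μ‖ ≤ b
    refine (norm_integral_le_of_norm_le (hi.mul_const b) (.of_forall fun t => ?_)).trans h1.le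
    rw [norm_mul, Real.norm_of_nonneg (η.nonneg_normed t)]
    exact mul_le_mul_of_nonneg_left (hb _) (η.nonneg_normed t)
  · intro x
    rw [← Real.dist_eq]
    refine η.dist_normed_convolution_le hψ.continuous.aestronglyMeasurable fun y hy => ?_
    exact (hψ.dist_le_mul y x).trans (by gcongr; exact (mem_ball.1 hy).le)
  · intro x hx
    rw [η.normed_convolution_eq_right fun y hy => by
      rw [hx y hy, hx x (mem_ball_self hε)]]
    exact hx x (mem_ball_self hε)

end Mollify

local notation "𝔼" => EuclideanSpace ℝ (Fin 2)

theorem volume_real_ball (z : 𝔼) {r : ℝ} (hr : 0 ≤ r) :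
    volume.real (ball z r) = Real.pi * r ^ 2 := by
  rw [measureReal_def, EuclideanSpace.volume_ball_fin_two]
  rw [ENNReal.toReal_mul, ENNReal.toReal_pow, ENNReal.toReal_ofReal hr,
    ENNReal.toReal_ofReal Real.pi_nonneg, mul_comm]

/-! ### From smooth to Lipschitz test functions in the local maximal function. -/

section LocalMaximal

variable {μ : Measure (EuclideanSpace ℝ (Fin 2))} {f : EuclideanSpace ℝ (Fin 2) → ℝ}

theorem enorm_integral_le_localMaximal {φ : 𝔼 → ℝ} (hφ : φ ∈ testFunctions 2) {r : ℝ}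
    (hr : 0 < r) (hr1 : r ≤ 1) (z : 𝔼) :
    ENNReal.ofReal |∫ y, φ (r⁻¹ • (z - y)) * f y ∂μ| ≤
      ENNReal.ofReal (Real.pi * r ^ 2) * localMaximal μ f z := by
  have h1 : ‖(volume.real (ball z r))⁻¹ * ∫ y, φ (r⁻¹ • (z - y)) * f y ∂μ‖ₑ ≤
      localMaximal μ f z :=
    le_iSup₂_of_le φ hφ (le_iSup₂_of_le r hr (le_iSup_of_le hr1 le_rfl))
  have hp : 0 < Real.pi * r ^ 2 := by positivity
  rw [volume_real_ball z hr.le] at h1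
  calc ENNReal.ofReal |∫ y, φ (r⁻¹ • (z - y)) * f y ∂μ|
      = ENNReal.ofReal (Real.pi * r ^ 2) *
        ‖(Real.pi * r ^ 2)⁻¹ * ∫ y, φ (r⁻¹ • (z - y)) * f y ∂μ‖ₑ := by
        rw [Real.enorm_eq_ofReal_abs, ← ENNReal.ofReal_mul hp.le, abs_mul,
          abs_of_pos (inv_pos.2 hp), mul_inv_cancel_left₀ hp.ne']
    _ ≤ _ := by gcongr

theorem smooth_test_le_localMaximal {Φ : 𝔼 → ℝ} {r : ℝ} (hr : 0 < r) (hr4 : r ≤ 1 / 4) (z : 𝔼)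
    (hΦ : ContDiff ℝ (⊤ : ℕ∞) Φ) (hL : ∀ x y, |Φ x - Φ y| ≤ 2 / r * dist x y)
    (hb : ∀ x, |Φ x| ≤ 1) (hs : ∀ x, Φ x ≠ 0 → dist x z ≤ 3 * r) :
    ENNReal.ofReal |∫ y, Φ y * f y ∂μ| ≤ ENNReal.ofReal (512 * r ^ 2) * localMaximal μ f z := by
  -- Rescaling by 4r shrinks the support to radius 3/4 < 1 and uses the radius 4r ≤ 1; the factor
  -- 1/8 makes the Lipschitz constant (1/8)(2/r)(4r) = 1. Undoing it costs 8 π (4r)² ≤ 512 r².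
  set φ : 𝔼 → ℝ := fun w => 1 / 8 * Φ (z - (4 * r) • w) with hφ
  have hsupp : Function.support φ ⊆ closedBall 0 (3 / 4) := by
    intro w hw
    have h1 : Φ (z - (4 * r) • w) ≠ 0 := fun h => hw (by simp only [hφ, h, mul_zero])
    have h2 := hs _ h1
    rw [dist_eq_norm, sub_sub_cancel_left, norm_neg, norm_smul, Real.norm_of_nonneg (by positivity)]
      at h2
    rw [mem_closedBall_zero_iff]
    nlinarith
  have hφL : LipschitzWith 1 φ := LipschitzWith.of_dist_le_mul fun w w' => by
    have h1 := hL (z - (4 * r) • w) (z - (4 * r) • w')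
    rw [dist_sub_left, dist_smul₀, Real.norm_of_nonneg (by positivity)] at h1
    rw [Real.dist_eq, hφ, ← mul_sub, abs_mul, abs_of_pos (by norm_num : (0 : ℝ) < 1 / 8)]
    calc _ ≤ 1 / 8 * (2 / r * (4 * r * dist w w')) := by gcongr
      _ = _ := by simp only [NNReal.coe_one]; field_simp; norm_num
  have hmem : φ ∈ testFunctions 2 := by
    refine ⟨?_, ?_, ?_, ?_, ?_⟩
    · exact contDiff_const.mul (hΦ.comp (contDiff_const.sub (contDiff_id.const_smul (4 * r))))
    · exact HasCompactSupport.of_support_subset_isCompact (isCompact_closedBall 0 (3 / 4)) hsupp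
    · exact (closure_minimal hsupp isClosed_closedBall).trans
        (closedBall_subset_ball (by norm_num))
    · intro w
      rw [hφ, abs_mul, abs_of_pos (by norm_num : (0 : ℝ) < 1 / 8)]
      linarith [hb (z - (4 * r) • w)]
    · intro w
      exact norm_fderiv_le_of_lipschitz ℝ hφL
  have h1 := enorm_integral_le_localMaximal (μ := μ) (f := f) hmem (r := 4 * r) (by positivity)
    (by linarith) z
  have e : ∀ y, φ ((4 * r)⁻¹ • (z - y)) * f y = 1 / 8 * (Φ y * f y) := by
    intro y
    simp only [hφ]
    rw [smul_inv_smul₀ (by positivity), sub_sub_cancel, mul_assoc]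
  simp only [e] at h1
  rw [integral_const_mul, abs_mul, abs_of_pos (by norm_num : (0 : ℝ) < 1 / 8)] at h1
  calc ENNReal.ofReal |∫ y, Φ y * f y ∂μ|
      = ENNReal.ofReal 8 * ENNReal.ofReal (1 / 8 * |∫ y, Φ y * f y ∂μ|) := by
        rw [← ENNReal.ofReal_mul (by norm_num)]; congr 1; ring
    _ ≤ ENNReal.ofReal 8 * (ENNReal.ofReal (Real.pi * (4 * r) ^ 2) * localMaximal μ f z) := by
        gcongr
    _ = ENNReal.ofReal (128 * Real.pi * r ^ 2) * localMaximal μ f z := by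
        rw [← mul_assoc, ← ENNReal.ofReal_mul (by norm_num)]; congr 2; ring
    _ ≤ _ := by
        gcongr
        linarith [Real.pi_lt_four]

/-- Mollification at scale ε ≤ r enlarges the support from 2r to at most 3r and changes the integral
by O(ε) since f is integrable; then ε tends to zero. -/
theorem lipschitz_test_le_localMaximal (hf : Integrable f μ) {Φ : 𝔼 → ℝ} {r : ℝ} (hr : 0 < r)
    (hr4 : r ≤ 1 / 4) (z : 𝔼) (hL : ∀ x y, |Φ x - Φ y| ≤ 2 / r * dist x y)
    (hb : ∀ x, |Φ x| ≤ 1) (hs : ∀ x, Φ x ≠ 0 → dist x z ≤ 2 * r) :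
    ENNReal.ofReal |∫ y, Φ y * f y ∂μ| ≤ ENNReal.ofReal (512 * r ^ 2) * localMaximal μ f z := by
  rcases eq_or_ne (localMaximal μ f z) ⊤ with htop | htop
  · rw [htop, ENNReal.mul_top (by simpa using by positivity)]
    exact le_top
  have hK : (0 : ℝ) ≤ 2 / r := by positivity
  have hLip : LipschitzWith (Real.toNNReal (2 / r)) Φ := LipschitzWith.of_dist_le_mul fun x y => by
    rw [Real.coe_toNNReal _ hK]; exact hL x y
  rw [← ENNReal.ofReal_toReal htop, ← ENNReal.ofReal_mul (by positivity),
    ENNReal.ofReal_le_ofReal_iff (by positivity)]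
  have hΦi : ∀ {Ψ : 𝔼 → ℝ}, Continuous Ψ → (∀ x, |Ψ x| ≤ 1) → Integrable (fun y => Ψ y * f y) μ :=
    fun hc hb => hf.bdd_mul (c := 1) hc.aestronglyMeasurable (.of_forall hb)
  have hI : 0 ≤ ∫ y, |f y| ∂μ := integral_nonneg fun _ => abs_nonneg _
  have key : ∀ ε, 0 < ε → ε ≤ r → |∫ y, Φ y * f y ∂μ| ≤
      512 * r ^ 2 * (localMaximal μ f z).toReal + ε * (2 / r * ∫ y, |f y| ∂μ) := by
    intro ε hε hεr
    obtain ⟨Ψ, hΨ, hΨL, hΨb, hΨa, hΨs⟩ :=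
      exists_contDiff_lipschitzWith_approx volume hLip hb hε
    rw [Real.coe_toNNReal _ hK] at hΨa
    have h1 := smooth_test_le_localMaximal (μ := μ) (f := f) hr hr4 z hΨ (fun x y => by
      have := hΨL.dist_le_mul x y
      rwa [Real.coe_toNNReal _ hK] at this) hΨb (fun x hx => by
        by_contra! h
        refine hx (hΨs x fun y hy => ?_)
        by_contra h0
        have h2 := hs y h0
        rw [mem_ball] at hy
        have := dist_triangle_left x z y
        linarith)
    rw [← ENNReal.ofReal_toReal htop, ← ENNReal.ofReal_mul (by positivity),
      ENNReal.ofReal_le_ofReal_iff (by positivity)] at h1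
    have h2 : |(∫ y, Ψ y * f y ∂μ) - ∫ y, Φ y * f y ∂μ| ≤ ε * (2 / r * ∫ y, |f y| ∂μ) := by
      rw [← integral_sub (hΦi hΨ.continuous hΨb) (hΦi hLip.continuous hb),
        ← integral_const_mul, ← integral_const_mul]
      change ‖∫ y, (Ψ y * f y - Φ y * f y) ∂μ‖ ≤ _
      refine norm_integral_le_of_norm_le ((hf.abs.const_mul _).const_mul _)
        (.of_forall fun y => ?_)
      rw [← sub_mul, norm_mul, Real.norm_eq_abs, Real.norm_eq_abs]
      calc _ ≤ 2 / r * ε * |f y| := by gcongr; exact hΨa y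
        _ = _ := by ring
    have h3 := abs_sub_abs_le_abs_sub (∫ y, Φ y * f y ∂μ) (∫ y, Ψ y * f y ∂μ)
    rw [abs_sub_comm] at h3
    linarith
  have hlim : Tendsto (fun ε : ℝ => 512 * r ^ 2 * (localMaximal μ f z).toReal +
      ε * (2 / r * ∫ y, |f y| ∂μ)) (𝓝[>] 0)
      (𝓝 (512 * r ^ 2 * (localMaximal μ f z).toReal + 0 * (2 / r * ∫ y, |f y| ∂μ))) :=
    ((tendsto_id.mono_left nhdsWithin_le_nhds).mul_const _).const_add _
  rw [zero_mul, add_zero] at hlim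
  refine ge_of_tendsto hlim ?_
  filter_upwards [Ioc_mem_nhdsGT hr] with ε hε using key ε hε.1 hε.2

/-- For fixed φ and r the average is continuous in x, and a supremum of continuous functions is
lower semicontinuous. Its superlevel sets are therefore open. -/
theorem lowerSemicontinuous_localMaximal (hf : Integrable f μ) :
    LowerSemicontinuous (localMaximal μ f) := by
  unfold localMaximal
  refine lowerSemicontinuous_biSup fun φ hφ => lowerSemicontinuous_iSup fun r =>
    lowerSemicontinuous_biSup fun hr hr1 => Continuous.lowerSemicontinuous ?_
  simp only [volume_real_ball _ (le_of_lt hr)]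
  refine continuous_enorm.comp (continuous_const.mul ?_)
  refine continuous_of_dominated (bound := fun y => |f y|) (fun x => ?_)
    (fun x => .of_forall fun y => ?_) hf.abs (.of_forall fun y => ?_)
  · have hφc := hφ.1.continuous
    have hc : Continuous fun y => φ (r⁻¹ • (x - y)) := by fun_prop
    exact hc.aestronglyMeasurable.mul hf.aestronglyMeasurable
  · rw [norm_mul]
    exact mul_le_of_le_one_left (abs_nonneg _) (hφ.2.2.2.1 _)
  · have hφc := hφ.1.continuous
    fun_prop

end LocalMaximal

/-! ### Squares inside the unit square. -/

section Cubes

theorem cube_eq_preimage (a : 𝔼) (l : ℝ) :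
    cube a l = WithLp.ofLp ⁻¹' Set.Icc (WithLp.ofLp a) (fun i => a i + l) := by
  ext x
  simp only [cube, Set.mem_Icc, Set.mem_preimage, Pi.le_def]
  exact forall_and

theorem measurableSet_cube (a : 𝔼) (l : ℝ) : MeasurableSet (cube a l) := by
  rw [cube_eq_preimage]
  exact (PiLp.volume_preserving_ofLp (Fin 2)).measurable measurableSet_Icc

theorem volume_cube (a : 𝔼) {l : ℝ} (hl : 0 ≤ l) : volume (cube a l) = ENNReal.ofReal (l ^ 2) := by
  rw [cube_eq_preimage, (PiLp.volume_preserving_ofLp (Fin 2)).measure_preimage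
    measurableSet_Icc.nullMeasurableSet, Real.volume_Icc_pi]
  simp [sq, ENNReal.ofReal_mul hl]

theorem torus_eq_cube : torus 2 = cube (WithLp.toLp 2 fun _ => -(1 / 2)) 1 := by
  ext x
  simp only [torus, cube]
  norm_num

/-- The square of side s centred at x is pushed into the unit square by clamping its corner; no
point of the unit square is lost by this. -/
theorem exists_cube_near (x : 𝔼) {s : ℝ} (hs1 : s ≤ 1) :
    ∃ a, cube a s ⊆ torus 2 ∧
      ∀ y ∈ torus 2, (∀ i, |y i - x i| ≤ s / 2) → y ∈ cube a s := by
  refine ⟨WithLp.toLp 2 fun i => max (-(1 / 2)) (min (x i - s / 2) (1 / 2 - s)), ?_, ?_⟩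
  · intro y hy i
    obtain ⟨h1, h2⟩ := hy i
    refine ⟨(le_max_left _ _).trans h1, h2.trans ?_⟩
    have : max (-(1 / 2)) (min (x i - s / 2) (1 / 2 - s)) ≤ 1 / 2 - s :=
      max_le (by linarith) (min_le_right _ _)
    simp only
    linarith
  · intro y hy hyx i
    obtain ⟨h1, h2⟩ := hy i
    obtain ⟨h3, h4⟩ := abs_le.1 (hyx i)
    refine ⟨max_le h1 ((min_le_left _ _).trans (by linarith)), ?_⟩
    have : min (x i - s / 2) (1 / 2 - s) ≤ max (-(1 / 2)) (min (x i - s / 2) (1 / 2 - s)) :=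
      le_max_right _ _
    simp only
    rcases min_choice (x i - s / 2) (1 / 2 - s) with h | h <;> rw [h] at this ⊢ <;> linarith

theorem cube_subset_ball {a x : 𝔼} {s : ℝ} (hs : 0 < s) (hx : x ∈ cube a s) :
    cube a s ⊆ ball x (2 * s) := by
  intro y hy
  have h (i : Fin 2) : (y i - x i) ^ 2 ≤ s ^ 2 := by
    obtain ⟨h1, h2⟩ := hy i
    obtain ⟨h3, h4⟩ := hx i
    exact sq_le_sq' (by linarith) (by linarith)
  rw [mem_ball, EuclideanSpace.dist_eq, Real.sqrt_lt' (by positivity), Fin.sum_univ_two,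
    Real.dist_eq, Real.dist_eq, sq_abs, sq_abs]
  nlinarith [h 0, h 1]

theorem abs_apply_sub_le_dist (x y : 𝔼) (i : Fin 2) : |y i - x i| ≤ dist y x := by
  rw [dist_eq_norm]
  exact PiLp.norm_apply_le (y - x) i

end Cubes

/-! ### The unit square as a planar metric measure space. -/

theorem measurableSet_torus : MeasurableSet (torus 2) := by
  rw [torus_eq_cube]
  exact measurableSet_cube _ _

theorem volume_torus : volume (torus 2) = 1 := by
  rw [torus_eq_cube, volume_cube _ zero_le_one]
  simp

instance : IsProbabilityMeasure (torusMeasure 2) :=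
  ⟨by rw [torusMeasure, Measure.restrict_apply_univ, volume_torus]⟩

/-- Lebesgue measure on the torus, seen as a type. -/
noncomputable def torusVolume : Measure (torus 2) := Measure.comap Subtype.val volume

theorem measurePreserving_val : MeasurePreserving Subtype.val torusVolume (torusMeasure 2) :=
  ⟨measurable_subtype_coe, map_comap_subtype_coe measurableSet_torus _⟩

theorem measurableEmbedding_val : MeasurableEmbedding (Subtype.val : torus 2 → 𝔼) :=
  MeasurableEmbedding.subtype_coe measurableSet_torus

instance : IsProbabilityMeasure torusVolume :=
  ⟨by rw [← Set.preimage_univ (f := (Subtype.val : torus 2 → 𝔼)),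
    measurePreserving_val.measure_preimage nullMeasurableSet_univ, measure_univ]⟩

theorem torusVolume_real_ball (x : torus 2) (r : ℝ) :
    torusVolume.real (ball x r) = (torusMeasure 2).real (ball (x : 𝔼) r) := by
  rw [measureReal_def, measureReal_def,
    ← measurePreserving_val.measure_preimage measurableSet_ball.nullMeasurableSet]
  rfl

theorem isPlanar_torusVolume : IsPlanar torusVolume where
  lower x r hr hr1 := by
    obtain ⟨a, ha, hxa⟩ := exists_cube_near x (s := r / 2) (by linarith)
    have hx := hxa x x.2 fun i => by simpa using by positivity
    have hsub := cube_subset_ball (by positivity) hx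
    rw [mul_div_cancel₀ r two_ne_zero] at hsub
    rw [torusVolume_real_ball]
    calc r ^ 2 / 4 = (volume (cube a (r / 2))).toReal := by
          rw [volume_cube _ (by positivity), ENNReal.toReal_ofReal (by positivity)]; ring
      _ = (torusMeasure 2).real (cube a (r / 2)) := by
          rw [torusMeasure, measureReal_restrict_apply (measurableSet_cube _ _),
            Set.inter_eq_left.2 ha, measureReal_def]
      _ ≤ _ := measureReal_mono hsub
  upper x r hr := by
    rw [torusVolume_real_ball, torusMeasure, measureReal_restrict_apply measurableSet_ball]
    calc _ ≤ volume.real (ball (x : 𝔼) r) :=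
          measureReal_mono Set.inter_subset_left measure_ball_lt_top.ne
      _ = Real.pi * r ^ 2 := volume_real_ball _ hr.le
      _ ≤ _ := by gcongr; exact Real.pi_lt_four.le

/-! ### From mean oscillation on squares to oscillation on balls. -/

section BMO

variable {g : EuclideanSpace ℝ (Fin 2) → ℝ}

theorem integral_cube_abs_sub_average_le (hg : Integrable g (torusMeasure 2))
    (hb : bmoNorm (torus 2) g ≠ ⊤) {a : 𝔼} {l : ℝ} (hl : 0 < l) (ha : cube a l ⊆ torus 2) :
    ∫ x in cube a l, |g x - ⨍ y in cube a l, g y| ≤ (bmoNorm (torus 2) g).toReal * l ^ 2 := by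
  set m := ⨍ y in cube a l, g y
  have hv := volume_cube a hl.le
  have hl2 : 0 < l ^ 2 := by positivity
  have h1 : (volume (cube a l))⁻¹ * ∫⁻ x in cube a l, ‖g x - m‖ₑ ≤ bmoNorm (torus 2) g :=
    le_iSup₂_of_le a l (le_iSup₂_of_le hl ha le_rfl)
  rw [hv, mul_comm, ← div_eq_mul_inv, ENNReal.div_le_iff (by simpa using by positivity) (by simp),
    ← ENNReal.ofReal_toReal hb, ← ENNReal.ofReal_mul ENNReal.toReal_nonneg] at h1
  have : IsFiniteMeasure (volume.restrict (cube a l)) := ⟨by simp [hv]⟩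
  have hi : Integrable (fun x => g x - m) (volume.restrict (cube a l)) :=
    (hg.mono_measure (Measure.restrict_mono ha le_rfl)).sub (integrable_const m)
  rw [← ofReal_integral_norm_eq_lintegral_enorm hi, ENNReal.ofReal_le_ofReal_iff (by positivity)]
    at h1
  exact h1

theorem average_torus : ⨍ y in torus 2, g y = ∫ y, g y ∂torusMeasure 2 := by
  rw [setAverage_eq, measureReal_def, volume_torus]
  simp [torusMeasure]

theorem integral_torusVolume (h : 𝔼 → ℝ) :
    ∫ x : torus 2, h x ∂torusVolume = ∫ x, h x ∂torusMeasure 2 :=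
  measurePreserving_val.integral_comp measurableEmbedding_val h

theorem integral_torus_abs_sub_le (hg : Integrable g (torusMeasure 2))
    (hb : bmoNorm (torus 2) g ≠ ⊤) :
    ∫ x, |g x - ∫ y, g y ∂torusMeasure 2| ∂torusMeasure 2 ≤ (bmoNorm (torus 2) g).toReal := by
  have h := integral_cube_abs_sub_average_le hg hb one_pos torus_eq_cube.ge
  rw [← torus_eq_cube, average_torus] at h
  rwa [one_pow, mul_one] at h

theorem hasOscillation_of_bmoNorm (hg : Integrable g (torusMeasure 2))
    (hb : bmoNorm (torus 2) g ≠ ⊤) :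
    HasOscillation torusVolume (fun x : torus 2 => g x) (4 * (bmoNorm (torus 2) g).toReal) := by
  intro y r hr
  -- For r ≤ 1/2 a square of side 2r pushed inside the unit square covers the ball; for larger r the
  -- whole unit square does. In both cases l² ≤ 4 r², the source of the factor 4.
  have key : ∃ a l m, cube a l ⊆ torus 2 ∧ l ≤ 2 * r ∧ torus 2 ∩ ball (y : 𝔼) r ⊆ cube a l ∧
      ∫ x in cube a l, |g x - m| ≤ (bmoNorm (torus 2) g).toReal * l ^ 2 ∧ 0 < l := by
    rcases le_total (1 / 2) r with h | h
    · exact ⟨_, 1, _, torus_eq_cube.ge, by linarith, torus_eq_cube ▸ Set.inter_subset_left,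
        integral_cube_abs_sub_average_le hg hb one_pos torus_eq_cube.ge, one_pos⟩
    · obtain ⟨a, ha, hya⟩ := exists_cube_near y (s := 2 * r) (by linarith)
      refine ⟨a, 2 * r, _, ha, le_rfl, fun x hx => hya x hx.1 fun i => ?_,
        integral_cube_abs_sub_average_le hg hb (by positivity) ha, by positivity⟩
      rw [mul_div_cancel_left₀ r two_ne_zero]
      exact (abs_apply_sub_le_dist _ _ i).trans (mem_ball.1 hx.2).le
  obtain ⟨a, l, m, ha, hlr, hsub, hm, hl⟩ := key
  refine ⟨m, ?_⟩
  have e : ∫ x in ball y r, |g x - m| ∂torusVolume =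
      ∫ x in ball (y : 𝔼) r, |g x - m| ∂torusMeasure 2 :=
    measurePreserving_val.setIntegral_preimage_emb measurableEmbedding_val (fun x => |g x - m|)
      (ball (y : 𝔼) r)
  rw [e, torusMeasure, Measure.restrict_restrict measurableSet_ball, Set.inter_comm]
  have : IsFiniteMeasure (volume.restrict (cube a l)) := ⟨by simp [volume_cube a hl.le]⟩
  have hi : IntegrableOn (fun x => |g x - m|) (cube a l) :=
    ((hg.mono_measure (Measure.restrict_mono ha le_rfl)).sub (integrable_const m)).abs
  calc _ ≤ ∫ x in cube a l, |g x - m| :=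
        setIntegral_mono_set hi (.of_forall fun _ => abs_nonneg _) (LE.le.eventuallyLE hsub)
    _ ≤ (bmoNorm (torus 2) g).toReal * (2 * r) ^ 2 := hm.trans (by gcongr)
    _ = _ := by ring

end BMO

/-! ### The local maximal function on the square and the final estimate. -/

theorem isMaximalBound_localMaximal {f : 𝔼 → ℝ} (hf : Integrable f (torusMeasure 2)) :
    IsMaximalBound torusVolume (fun x : torus 2 => f x)
      (fun x => ENNReal.ofReal 512 * localMaximal (torusMeasure 2) f x) where
  isOpen t := by
    have h := (lowerSemicontinuous_localMaximal hf).isOpen_preimage (t / ENNReal.ofReal 512)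
    have e : {x : torus 2 | t < ENNReal.ofReal 512 * localMaximal (torusMeasure 2) f x} =
        Subtype.val ⁻¹' (localMaximal (torusMeasure 2) f ⁻¹' Set.Ioi (t / ENNReal.ofReal 512)) := by
      refine Set.ext fun x => ?_
      change t < _ ↔ t / _ < _
      rw [ENNReal.div_lt_iff (Or.inl (by simp)) (Or.inl (by simp)), mul_comm]
    rw [e]
    exact h.preimage continuous_subtype_val
  test z r hr hr4 ψ hψ1 hψL hψs := by
    have hr' : (0 : ℝ) ≤ 1 / r := by positivity
    have hLip : LipschitzWith (Real.toNNReal (1 / r)) ψ := LipschitzWith.of_dist_le_mul fun x y => by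
      rw [Real.coe_toNNReal _ hr', Real.dist_eq]
      exact (hψL x y).trans (le_of_eq (by ring))
    obtain ⟨Ψ, hΨL, hΨ⟩ : ∃ Ψ : 𝔼 → ℝ, LipschitzWith (Real.toNNReal (1 / r)) Ψ ∧
        ∀ x : torus 2, Ψ x = ψ x := by
      obtain ⟨Ψ, hL, hE⟩ := LipschitzOnWith.extend_real (s := torus 2)
        (f := fun x => open Classical in if h : x ∈ torus 2 then ψ ⟨x, h⟩ else 0)
        (K := Real.toNNReal (1 / r)) (LipschitzOnWith.of_dist_le_mul fun x hx y hy => by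
          simp only [hx, hy, dite_true]
          exact hLip.dist_le_mul ⟨x, hx⟩ ⟨y, hy⟩)
      refine ⟨Ψ, hL, fun x => ?_⟩
      rw [← hE x.2]
      simp
    -- The Lipschitz extension to the plane need not have small support, so it is truncated and
    -- multiplied by a cutoff equal to 1 within r of `z` and 0 beyond 2r; the product has Lipschitz
    -- constant 2/r.
    set χ : 𝔼 → ℝ := fun y => max 0 (min 1 (2 - dist y z / r)) with hχ
    have hχ0 : ∀ y, 0 ≤ χ y := fun y => le_max_left _ _
    have hχ1 : ∀ y, χ y ≤ 1 := fun y => max_le zero_le_one (min_le_left _ _)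
    have hχL : ∀ x y, |χ x - χ y| ≤ dist x y / r := fun x y => by
      have h0 : 0 ≤ dist x y / r := by positivity
      refine (abs_max_sub_max_le_max _ _ _ _).trans (max_le (by simpa using h0) ?_)
      refine (abs_min_sub_min_le_max _ _ _ _).trans (max_le (by simpa using h0) ?_)
      rw [sub_sub_sub_cancel_left, ← sub_div, abs_div, abs_of_pos hr, abs_sub_comm]
      gcongr
      exact abs_dist_sub_le _ _ _
    set Φ : 𝔼 → ℝ := fun y => truncate 1 (Ψ y) * χ y with hΦ
    have hΦL : ∀ x y, |Φ x - Φ y| ≤ 2 / r * dist x y := fun x y => by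
      have h1 : |truncate 1 (Ψ x) - truncate 1 (Ψ y)| ≤ dist x y / r := by
        have h2 := hΨL.dist_le_mul x y
        rw [Real.coe_toNNReal _ hr', Real.dist_eq] at h2
        exact (abs_truncate_sub_le _ _ _).trans (h2.trans (le_of_eq (by ring)))
      have e : Φ x - Φ y = (truncate 1 (Ψ x) - truncate 1 (Ψ y)) * χ x +
          truncate 1 (Ψ y) * (χ x - χ y) := by rw [hΦ]; ring
      rw [e]
      refine (abs_add_le _ _).trans ?_
      rw [abs_mul, abs_mul, abs_of_nonneg (hχ0 x)]
      calc _ ≤ dist x y / r * 1 + 1 * (dist x y / r) := by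
            gcongr
            · exact hχ1 x
            · exact abs_truncate_le zero_le_one _
            · exact hχL x y
        _ = _ := by ring
    have hΦ1 : ∀ y, |Φ y| ≤ 1 := fun y => by
      rw [hΦ, abs_mul, abs_of_nonneg (hχ0 y)]
      exact mul_le_one₀ (abs_truncate_le zero_le_one _) (hχ0 y) (hχ1 y)
    have hΦs : ∀ y, Φ y ≠ 0 → dist y z ≤ 2 * r := fun y hy => by
      by_contra! h
      refine right_ne_zero_of_mul hy (max_eq_left ((min_le_right _ _).trans ?_))
      rw [sub_nonpos, le_div_iff₀ hr]
      exact h.le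
    have hΦψ : ∀ x : torus 2, Φ x = ψ x := fun x => by
      simp only [hΦ]
      rw [hΨ, truncate_eq (hψ1 x)]
      by_cases h : ψ x = 0
      · rw [h, zero_mul]
      · have h1 : dist (x : 𝔼) z / r ≤ 1 := (div_le_one hr).2 (hψs x h)
        have h2 : χ x = 1 := by
          simp only [hχ]
          rw [min_eq_left (by linarith), max_eq_right zero_le_one]
        rw [h2, mul_one]
    have h := lipschitz_test_le_localMaximal hf hr hr4 z hΦL hΦ1 hΦs
    rw [← integral_torusVolume fun y => Φ y * f y] at h
    simp only [hΦψ] at h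
    rwa [mul_comm 512, ENNReal.ofReal_mul (by positivity), mul_assoc] at h

end TorusDuality

theorem mainTheorem5 :
    ∃ C : NNReal, ∀ f g : EuclideanSpace ℝ (Fin 2) → ℝ,
      Integrable f (TorusDuality.torusMeasure 2) →
      Integrable g (TorusDuality.torusMeasure 2) →
      Integrable (fun x => f x * g x) (TorusDuality.torusMeasure 2) →
      (∫ x, f x ∂(TorusDuality.torusMeasure 2) = 0 ∨
        ∫ x, g x ∂(TorusDuality.torusMeasure 2) = 0) →
      ENNReal.ofReal |∫ x, f x * g x ∂(TorusDuality.torusMeasure 2)| ≤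
        (C : ENNReal) *
          (∫⁻ x, TorusDuality.localMaximal (TorusDuality.torusMeasure 2) f x
            ∂(TorusDuality.torusMeasure 2)) *
          TorusDuality.bmoNorm (TorusDuality.torus 2) g := by
  open TorusDuality in
  refine ⟨10 ^ 36, fun f g hf hg hfg hmean => ?_⟩
  set μ := torusMeasure 2 with hμ
  set c := ∫ x, g x ∂μ with hc
  -- The correction is c ∫ f, which vanishes if f has mean zero and also if g does, since then c =
  -- 0.
  have hpair : ∫ x, f x * g x ∂μ = ∫ x, f x * (g x - c) ∂μ := by
    simp only [mul_sub]
    rw [integral_sub hfg (hf.mul_const c), integral_mul_const]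
    rcases hmean with h | h <;> rw [h] <;> simp
  rw [hpair]
  set I := ∫⁻ x, localMaximal μ f x ∂μ with hI
  set b := bmoNorm (torus 2) g with hb
  have hM := isMaximalBound_localMaximal hf
  have hMI : ∫⁻ x : torus 2, ENNReal.ofReal 512 * localMaximal μ f x ∂torusVolume =
      ENNReal.ofReal 512 * I := by
    rw [lintegral_const_mul' _ _ ENNReal.ofReal_ne_top, hI,
      ← measurePreserving_val.lintegral_comp_emb measurableEmbedding_val]
  have hf' : Integrable (fun x : torus 2 => f x) torusVolume :=
    (measurePreserving_val.integrable_comp_emb measurableEmbedding_val).2 hf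
  -- The zero cases come before the infinite ones because of the convention 0 · ∞ = 0. A vanishing
  -- BMO norm, tested on the whole square, makes g equal to its mean almost everywhere.
  rcases eq_or_ne b 0 with hb0 | hb0
  · have h1 := integral_torus_abs_sub_le hg (by rw [← hb, hb0]; simp)
    rw [← hb, hb0, ENNReal.toReal_zero] at h1
    have hi : Integrable (fun x => |g x - c|) μ := (hg.sub (integrable_const c)).abs
    have h2 := (integral_eq_zero_iff_of_nonneg (fun _ => abs_nonneg _) hi).1
      (le_antisymm h1 (integral_nonneg fun _ => abs_nonneg _))
    rw [integral_eq_zero_of_ae]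
    · simp
    · filter_upwards [h2] with x hx
      rw [abs_eq_zero.1 hx, mul_zero, Pi.zero_apply]
  rcases eq_or_ne I 0 with hI0 | hI0
  · rw [hI0, mul_zero, lintegral_eq_zero_iff hM.measurable] at hMI
    have h1 : ∀ᵐ x : torus 2 ∂torusVolume, f x * (g x - c) = 0 := by
      filter_upwards [hMI, hM.ae_abs_le isPlanar_torusVolume hf'] with x hx hx'
      rw [hx] at hx'
      have h2 := hx' (by simp)
      simp only [Pi.zero_apply, ENNReal.toReal_zero, mul_zero, abs_nonpos_iff] at h2
      rw [h2, zero_mul]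
    rw [← integral_torusVolume fun x => f x * (g x - c), integral_eq_zero_of_ae h1]
    simp
  rcases eq_or_ne I ⊤ with hIt | hIt
  · rw [hIt, ENNReal.mul_top (by simp), ENNReal.top_mul hb0]
    exact le_top
  rcases eq_or_ne b ⊤ with hbt | hbt
  · rw [hbt, ENNReal.mul_top (mul_ne_zero (by simp) hI0)]
    exact le_top
  have hfin : ∫⁻ x : torus 2, ENNReal.ofReal 512 * localMaximal μ f x ∂torusVolume ≠ ⊤ := by
    rw [hMI]
    exact ENNReal.mul_ne_top ENNReal.ofReal_ne_top hIt
  have h := hM.abs_integral_le isPlanar_torusVolume hf' hfin (c := c) (g := fun x : torus 2 => g x)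
    ((measurePreserving_val.integrable_comp_emb measurableEmbedding_val).2 hg)
    ((measurePreserving_val.integrable_comp_emb measurableEmbedding_val).2 hfg)
    (hasOscillation_of_bmoNorm hg hbt) (by
      rw [integral_torusVolume fun x => |g x - c|]
      refine (integral_torus_abs_sub_le hg hbt).trans ?_
      linarith [ENNReal.toReal_nonneg (a := bmoNorm (torus 2) g)])
  rw [integral_torusVolume fun x => f x * (g x - c), hMI, ENNReal.toReal_mul,
    ENNReal.toReal_ofReal (by norm_num), ← hb] at h
  rw [← ENNReal.ofReal_toReal hIt, ← ENNReal.ofReal_toReal hbt,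
    ← ENNReal.ofReal_coe_nnreal, ← ENNReal.ofReal_mul (by positivity),
    ← ENNReal.ofReal_mul (by positivity)]
  refine ENNReal.ofReal_le_ofReal (h.trans ?_)
  push_cast
  -- Here 512 comes from the comparison of test functions and 4 from passing from squares to balls.
  calc _ = 10 ^ 32 * 512 * 4 * I.toReal * b.toReal := by ring
    _ ≤ _ := by gcongr; norm_num
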